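/- Let $K$ be a field of characteristic $0$ and let $K\langle\langle x,y\rangle\rangle$ be the algebra of formal power series in two noncommuting variables. For $F\in K\langle\langle x,y\rangle\rangle$ let $A(F)=K\langle\langle x,y\rangle\rangle/(\partial_xF,\partial_yF)$, the quotient by the two-sided ideal generated by the cyclic derivatives of $F$, where on words $\partial_{z}(z_1\cdots z_r)=\sum_{s:\,z_s=z}z_{s+1}\cdots z_rz_1\cdots z_{s-1}$. Two potentials are identified if they differ by a linear combination of commutators. Write $x^2y^{\circlearrowleft}=x^2y+xyx+yx^2$. Let $F=x^2y^{\circlearrowleft}+F_4+\dots+F_r$, with $F_d$ a homogeneous noncommutative polynomial of degree $d$, and suppose that $A(F)$ is finite-dimensional over $K$. Then: (1) There is a composition $\varphi$ of finitely many invertible changes of variables of $K\langle\langle x,y\rangle\rangle$, each of the form $x\mapsto x,\ y\mapsto y+f(x,y)$ or $x\mapsto x+g(x,y),\ y\mapsto y$ with $f,g$ power series having only terms of degree $\ge 2$, and there is a polynomial $p\in K[y]$, such that $\varphi(F)=x^2y^{\circlearrowleft}+y^4p(y)$ modulo commutators. (2) Let $\varphi$ be any $K$-algebra automorphism of $K\langle\langle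 x,y\rangle\rangle$ and $p\in K[y]$ any polynomial with $\varphi(F)=x^2y^{\circlearrowleft}+y^4p(y)$ modulo commutators. Then the even part $p_{\mathrm{even}}$ of $p$ (the sum of the terms of $p$ with even exponent) is nonzero, and $A(F)\cong A(x^2y^{\circlearrowleft}+y^4p(y))$ as $K$-algebras. Let $k$ be the lowest exponent of a monomial occurring in $p$, and $2n$ the lowest exponent occurring in $p_{\mathrm{even}}$. Then the monomials $y^N$ for $0\le N\le 2n+k+5$ and $xy^{N-1}$ for $1\le N\le 2n+3$ form a linear basis of $A(x^2y^{\circlearrowleft}+y^4p(y))$. Moreover either $k=2n$ and $\dim_KA(F)=3(2n+3)$, or $k<2n$, $k$ is odd and $\dim_KA(F)=4n+k+9$. -/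

import Mathlib

noncomputable section

namespace PotAlg

open Finset

/-- The underlying space of `K⟨⟨x, y⟩⟩`: formal power series in two noncommuting variables, given by
their coefficients on words. The letter `0` stands for `x` and the letter `1` for `y`. -/
def NCSeries (K : Type*) : Type _ := List (Fin 2) → K

@[ext] theorem NCSeries.ext {K : Type*} {f g : NCSeries K} (h : ∀ w, f w = g w) : f = g := funext h

variable {K : Type*} [Field K]

instance : AddCommGroup (NCSeries K) := inferInstanceAs (AddCommGroup (List (Fin 2) → K))

instance : Module K (NCSeries K) := inferInstanceAs (Module K (List (Fin 2) → K))

/-- The series consisting of a single word with coefficient one. -/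
def word (v : List (Fin 2)) : NCSeries K := fun w => if w = v then 1 else 0

instance : One (NCSeries K) := ⟨word []⟩

/-- Multiplication extends concatenation of words: the coefficient of a word in a product is the
sum over all its factorizations into a prefix and a suffix. -/
instance : Mul (NCSeries K) :=
  ⟨fun f g w => ∑ i ∈ range (w.length + 1), f (w.take i) * g (w.drop i)⟩

theorem coeff_mul (f g : NCSeries K) (w : List (Fin 2)) :
    (f * g) w = ∑ i ∈ range (w.length + 1), f (w.take i) * g (w.drop i) := rfl

theorem coeff_one (w : List (Fin 2)) : (1 : NCSeries K) w = if w = [] then 1 else 0 := rfl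

theorem coeff_add (f g : NCSeries K) (w : List (Fin 2)) : (f + g) w = f w + g w := rfl

theorem coeff_smul (c : K) (f : NCSeries K) (w : List (Fin 2)) : (c • f) w = c * f w := rfl

theorem coeff_zero (w : List (Fin 2)) : (0 : NCSeries K) w = 0 := rfl

protected theorem mul_assoc (f g h : NCSeries K) : f * g * h = f * (g * h) := by
  ext w
  simp only [coeff_mul, sum_mul, mul_sum]
  rw [sum_sigma', sum_sigma']
  refine sum_bij' (fun a _ => ⟨a.2, a.1 - a.2⟩) (fun a _ => ⟨a.1 + a.2, a.1⟩) ?_ ?_ ?_ ?_ ?_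
  · rintro ⟨i, j⟩ hij
    simp only [mem_sigma, mem_range, List.length_take, List.length_drop] at hij ⊢
    omega
  · rintro ⟨i, j⟩ hij
    simp only [mem_sigma, mem_range, List.length_take, List.length_drop] at hij ⊢
    omega
  · rintro ⟨i, j⟩ hij
    simp only [mem_sigma, mem_range, List.length_take] at hij
    simp only [Sigma.mk.injEq, heq_eq_eq, and_true]
    omega
  · rintro ⟨i, j⟩ hij
    simp
  · rintro ⟨i, j⟩ hij
    simp only [mem_sigma, mem_range, List.length_take] at hij
    have hj : j ≤ i := by omega
    simp only [List.take_take, List.drop_drop, List.drop_take, min_eq_left hj,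
      Nat.add_sub_cancel' hj, mul_assoc]

instance : Ring (NCSeries K) where
  __ := (inferInstance : AddCommGroup (NCSeries K))
  mul_assoc := PotAlg.mul_assoc
  one_mul f := by
    ext w
    rw [coeff_mul, sum_eq_single 0]
    · simp [coeff_one]
    · intro i hi h0
      have : w.take i ≠ [] := by
        intro h
        rw [List.take_eq_nil_iff] at h
        rcases h with h | h
        · exact h0 h
        · subst h; simp at hi; exact h0 hi
      simp [coeff_one, this]
    · simp
  mul_one f := by
    ext w
    rw [coeff_mul, sum_eq_single w.length]
    · simp [coeff_one]
    · intro i hi h0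
      have : w.drop i ≠ [] := by
        intro h
        rw [List.drop_eq_nil_iff] at h
        simp only [mem_range] at hi
        omega
      simp [coeff_one, this]
    · simp
  left_distrib f g h := by
    ext w
    simp only [coeff_mul, coeff_add, mul_add, sum_add_distrib]
  right_distrib f g h := by
    ext w
    simp only [coeff_mul, coeff_add, add_mul, sum_add_distrib]
  zero_mul f := by
    ext w
    simp [coeff_mul, coeff_zero]
  mul_zero f := by
    ext w
    simp [coeff_mul, coeff_zero]

instance : Algebra K (NCSeries K) :=
  Algebra.ofModule
    (fun c f g => by
      ext w
      simp only [coeff_mul, coeff_smul, mul_sum, mul_assoc])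
    (fun c f g => by
      ext w
      simp only [coeff_mul, coeff_smul, mul_sum]
      exact sum_congr rfl fun i _ => by ring)

/-- The variable `x`. -/
def x : NCSeries K := word [0]

/-- The variable `y`. -/
def y : NCSeries K := word [1]

/-- `f` is homogeneous of degree `d`. Since there are finitely many words of length `d`, such an `f`
is a noncommutative polynomial. -/
def IsHomogeneous (f : NCSeries K) (d : ℕ) : Prop := ∀ w : List (Fin 2), w.length ≠ d → f w = 0

/-- All words that occur in `f` have length at least `d`. -/
def HasOrderGE (f : NCSeries K) (d : ℕ) : Prop := ∀ w : List (Fin 2), w.length < d → f w = 0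

/-- The sum `x²y + xyx + yx²` of the cyclic rotations of `x²y`. -/
def xxyCyc : NCSeries K := x * x * y + x * y * x + y * x * x

/-- The cyclic derivative with respect to the letter `j`, that is, the continuous linear map with
`∂_j (z₁ ⋯ z_r) = ∑_{s : z_s = j} z_{s+1} ⋯ z_r z₁ ⋯ z_{s-1}` on words. A pair consisting of a word
and a position `s` in it contributes to the word `u` exactly when `u = a ++ b` and the word is
`b ++ j :: a`, which gives the coefficient below. -/
def cyclicDeriv (j : Fin 2) (f : NCSeries K) : NCSeries K :=
  fun u => ∑ i ∈ range (u.length + 1), f (u.drop i ++ j :: u.take i)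

/-- The two-sided ideal of `K⟨⟨x, y⟩⟩` generated by the two cyclic derivatives of `F`. -/
def jacobianIdeal (F : NCSeries K) : TwoSidedIdeal (NCSeries K) :=
  TwoSidedIdeal.span {cyclicDeriv 0 F, cyclicDeriv 1 F}

/-- The algebra `A(F) = K⟨⟨x, y⟩⟩ / (∂F/∂x, ∂F/∂y)` with potential `F`. -/
abbrev PotentialAlgebra (F : NCSeries K) : Type _ := (jacobianIdeal F).ringCon.Quotient

/-- The class of a series in `A(F)`. -/
def toA (F : NCSeries K) (f : NCSeries K) : PotentialAlgebra F := (f : (jacobianIdeal F).ringCon.Quotient)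

/-- `F` and `G` are the same potential: they agree modulo the linear span of commutators, i.e. up to
cyclic rotation of words. -/
def CycEquiv (F G : NCSeries K) : Prop :=
  F - G ∈ Submodule.span K {c : NCSeries K | ∃ a b : NCSeries K, c = a * b - b * a}

/-- An elementary invertible change of variables: `x ↦ x, y ↦ y + f` or `x ↦ x + g, y ↦ y`, with
`f`, `g` having only terms of degree at least two. -/
def IsElementaryChange (φ : NCSeries K ≃ₐ[K] NCSeries K) : Prop :=
  (φ x = x ∧ HasOrderGE (φ y - y) 2) ∨ (φ y = y ∧ HasOrderGE (φ x - x) 2)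

/-- The potential `x²y + xyx + yx² + y⁴ p(y)`. -/
def normalForm (p : Polynomial K) : NCSeries K := xxyCyc + y ^ 4 * Polynomial.aeval y p

/-- The even part of a polynomial in one variable. -/
def evenPart (p : Polynomial K) : Polynomial K :=
  ∑ i ∈ p.support with Even i, Polynomial.monomial i (p.coeff i)

/-- The monomials `y^N` for `0 ≤ N ≤ 2n+k+5` and `x y^(N-1)` for `1 ≤ N ≤ 2n+3`, in `A(F)`. -/
def monomials (F : NCSeries K) (n k : ℕ) :
    Fin (2 * n + k + 6) ⊕ Fin (2 * n + 3) → PotentialAlgebra F :=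
  Sum.elim (fun N => toA F (y ^ (N : ℕ))) (fun N => toA F (x * y ^ (N : ℕ)))

end PotAlg

end

/-! Normal form. The substitution `z ↦ z - g z` changes a potential, modulo commutators, by `-∑ ∂_z
F * g z` plus terms quadratic in `g` (`taylor_mem_commFilt`). The derivatives of the leading part
are `3(xy + yx)` and `3x²`. Modulo these and cyclic rotation, two letters `x` can be moved together
and killed, and a word with a single `x` equals its own negative. Hence in each degree only the
power of `y` resists removal (`exists_y_pow_mul_sub_mem_tangentSpace`), and the normal form is
reached up to any finite order. Finite dimension supplies the rest: by a Nakayama argument the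
Jacobian ideal contains all series of some order `N` (`exists_filt_le_of_finite`). A tail of high
order is therefore cyclically of the form `∑ ∂_z F * g z`, and a convergent sequence of
substitutions removes it (`exists_isTangent_of_sub_mem_commFilt`). The limit is one automorphism
tangent to the identity, which is a product of two elementary changes.

Invariance. An automorphism carries the Jacobian ideal of `F` to that of `φ F` by a chain rule for
cyclic derivatives (`cyclicDeriv_algHom`). Its infinite sums give membership only up to arbitrarily
high order, and Nakayama closes the gap (`jacobianIdeal_le_comap`).

Basis. With `r = -(t⁴p)'/3` the relations of the normal form are `xy = -yx` and `x² = r(y)`. As `x`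
commutes with `x²`, `(r(y) - r(-y))x = 0`. The lowest odd exponent of `r` is `2n+3`, so `y^(2n+3) x
= 0`; multiplying by `x` and using that `r` has order `k+3` gives `y^(2n+k+6) = 0`. This proves
spanning (`span_monomials_eq_top`). Independence comes from an explicit module, a quotient of `K[t]
⊕ x K[t]` (`linearIndependent_monomials_of_dvd`). If the even part of `p` were zero, this module
could be taken arbitrarily large. -/

noncomputable section

namespace PotAlg

/-! ### Words, the order filtration, completeness, and automatic continuity of endomorphisms. -/

section

open Finset

variable {K : Type*} [Field K]

/-- The series consisting of a single letter. -/
def letter (z : Fin 2) : NCSeries K := word [z]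

theorem letter_one : (letter 1 : NCSeries K) = y := rfl

/-- The part of a series after a first letter `z`. -/
def shift (z : Fin 2) : NCSeries K →ₗ[K] NCSeries K where
  toFun f w := f (z :: w)
  map_add' _ _ := rfl
  map_smul' _ _ := rfl

theorem coeff_shift (z : Fin 2) (f : NCSeries K) (w : List (Fin 2)) : shift z f w = f (z :: w) :=
  rfl

/-- The constant coefficient. -/
def constCoeff : NCSeries K →ₗ[K] K where
  toFun f := f []
  map_add' _ _ := rfl
  map_smul' _ _ := rfl

theorem constCoeff_apply (f : NCSeries K) : constCoeff f = f [] := rfl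

theorem coeff_sub (f g : NCSeries K) (w : List (Fin 2)) : (f - g) w = f w - g w := rfl

theorem coeff_sum {ι : Type*} (s : Finset ι) (f : ι → NCSeries K) (w : List (Fin 2)) :
    (∑ i ∈ s, f i) w = ∑ i ∈ s, f i w := by
  classical
  induction s using Finset.induction_on with
  | empty => rfl
  | insert a s ha ih => rw [sum_insert ha, sum_insert ha, coeff_add, ih]

theorem coeff_mul_nil (f g : NCSeries K) : (f * g) [] = f [] * g [] := by
  simp [coeff_mul]

theorem shift_mul (z : Fin 2) (f g : NCSeries K) :
    shift z (f * g) = f [] • shift z g + shift z f * g := by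
  ext w
  rw [coeff_shift, coeff_mul, coeff_add, coeff_smul, coeff_mul, List.length_cons,
    sum_range_succ']
  simp [coeff_shift, add_comm]

theorem shift_one (z : Fin 2) : shift z (1 : NCSeries K) = 0 := by
  ext w; simp [coeff_shift, coeff_one, coeff_zero]

theorem letter_nil (z : Fin 2) : (letter z : NCSeries K) [] = 0 := by
  simp [letter, word]

theorem shift_letter (z z' : Fin 2) :
    shift z (letter z' : NCSeries K) = if z = z' then 1 else 0 := by
  ext w
  by_cases h : z = z' <;> simp [coeff_shift, letter, word, h, coeff_one, coeff_zero]

theorem shift_letter_mul (z z' : Fin 2) (f : NCSeries K) :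
    shift z (letter z' * f) = if z = z' then f else 0 := by
  rw [shift_mul, letter_nil, shift_letter]
  split_ifs <;> simp

theorem ext_shift {f g : NCSeries K} (h0 : f [] = g []) (h : ∀ z, shift z f = shift z g) :
    f = g := by
  ext w
  cases w with
  | nil => exact h0
  | cons z w => exact congrFun (h z) w

theorem eq_shift (f : NCSeries K) : f = f [] • 1 + ∑ z, letter z * shift z f := by
  refine ext_shift ?_ fun z => ?_
  · simp [coeff_add, coeff_smul, coeff_one, coeff_mul_nil, letter_nil]
  · rw [map_add, map_smul, shift_one, smul_zero, zero_add, map_sum]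
    simp [shift_letter_mul]

theorem coeff_mul_letter_nil (f : NCSeries K) (z : Fin 2) :
    (f * letter z : NCSeries K) [] = 0 := by
  rw [coeff_mul_nil, letter_nil, mul_zero]

theorem coeff_mul_letter (f : NCSeries K) (z z' : Fin 2) (w : List (Fin 2)) :
    (f * letter z : NCSeries K) (w ++ [z']) = if z' = z then f w else 0 := by
  induction w generalizing f with
  | nil =>
    have := congrFun (shift_mul z' f (letter z)) []
    rw [coeff_shift, coeff_add, coeff_smul, coeff_mul_letter_nil, shift_letter] at this
    rw [List.nil_append, this]
    split_ifs <;> simp [coeff_one, coeff_zero]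
  | cons a w ih =>
    have := congrFun (shift_mul a f (letter z)) (w ++ [z'])
    rw [coeff_shift, coeff_add, coeff_smul, ih, shift_letter] at this
    rw [List.cons_append, this]
    split_ifs <;> simp [coeff_one, coeff_zero, coeff_shift]

/-- The series of order at least `n`. -/
def filt (n : ℕ) : Submodule K (NCSeries K) where
  carrier := {f | HasOrderGE f n}
  add_mem' hf hg w hw := by rw [coeff_add, hf w hw, hg w hw, add_zero]
  zero_mem' _ _ := rfl
  smul_mem' c f hf w hw := by rw [coeff_smul, hf w hw, mul_zero]

theorem mem_filt {f : NCSeries K} {n : ℕ} : f ∈ filt n ↔ ∀ w : List (Fin 2), w.length < n → f w = 0 :=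
  Iff.rfl

theorem filt_zero (f : NCSeries K) : f ∈ filt 0 := fun _ hw => absurd hw (Nat.not_lt_zero _)

theorem filt_mono {m n : ℕ} (h : m ≤ n) {f : NCSeries K} (hf : f ∈ filt n) : f ∈ filt m :=
  fun w hw => hf w (hw.trans_le h)

theorem mem_filt_one {f : NCSeries K} : f ∈ filt 1 ↔ f [] = 0 := by
  rw [mem_filt]
  refine ⟨fun h => h [] (by simp), fun h w hw => ?_⟩
  rw [Nat.lt_one_iff, List.length_eq_zero_iff] at hw
  rw [hw, h]

theorem filt_succ {f : NCSeries K} {n : ℕ} :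
    f ∈ filt (n + 1) ↔ f [] = 0 ∧ ∀ z, shift z f ∈ filt n := by
  refine ⟨fun h => ⟨h [] (by simp), fun z w hw => h (z :: w) (by simpa using hw)⟩, ?_⟩
  rintro ⟨h0, h⟩ w hw
  cases w with
  | nil => exact h0
  | cons z w => exact h z w (by simpa using hw)

theorem shift_mem_filt {f : NCSeries K} {n : ℕ} (hf : f ∈ filt n) (z : Fin 2) :
    shift z f ∈ filt (n - 1) := by
  cases n with
  | zero => exact filt_zero _
  | succ n => exact (filt_succ.1 hf).2 z

theorem mul_mem_filt {f g : NCSeries K} {m n : ℕ} (hf : f ∈ filt m) (hg : g ∈ filt n) :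
    f * g ∈ filt (m + n) := by
  intro w hw
  rw [coeff_mul]
  refine sum_eq_zero fun i hi => ?_
  rw [mem_range] at hi
  by_cases him : i < m
  · rw [hf (w.take i) (by rw [List.length_take]; omega), zero_mul]
  · rw [hg (w.drop i) (by rw [List.length_drop]; omega), mul_zero]

theorem mul_mem_filt_left {f : NCSeries K} {m : ℕ} (hf : f ∈ filt m) (g : NCSeries K) :
    f * g ∈ filt m := mul_mem_filt hf (filt_zero g)

theorem mul_mem_filt_right (f : NCSeries K) {g : NCSeries K} {n : ℕ} (hg : g ∈ filt n) :
    f * g ∈ filt n := by simpa using mul_mem_filt (filt_zero f) hg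

theorem letter_mem_filt (z : Fin 2) : (letter z : NCSeries K) ∈ filt 1 :=
  mem_filt_one.2 (letter_nil z)

theorem eq_zero_of_forall_mem_filt {f : NCSeries K} (h : ∀ n, f ∈ filt n) : f = 0 := by
  ext w
  exact h (w.length + 1) w (Nat.lt_succ_self _)

theorem exists_limit (u : ℕ → NCSeries K) (h : ∀ n, u (n + 1) - u n ∈ filt n) :
    ∃ f, ∀ n, f - u n ∈ filt n := by
  have key : ∀ n k, u (n + k) - u n ∈ filt n := by
    intro n k
    induction k with
    | zero => simp
    | succ k ih =>
      have := add_mem (filt_mono (Nat.le_add_right n k) (h (n + k))) ih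
      rwa [sub_add_sub_cancel] at this
  refine ⟨fun w => u (w.length + 1) w, fun n w hw => ?_⟩
  obtain ⟨k, rfl⟩ := Nat.exists_eq_add_of_le (Nat.succ_le_of_lt hw)
  have := key (w.length + 1) k w (Nat.lt_succ_self _)
  rw [coeff_sub, sub_eq_zero] at this
  exact sub_eq_zero.2 this.symm

theorem exists_mul_eq_one_of_mem_filt {f : NCSeries K} (hf : f ∈ filt 1) :
    ∃ g, (1 - f) * g = 1 ∧ g * (1 - f) = 1 := by
  have hpow : ∀ n, f ^ n ∈ filt n := by
    intro n
    induction n with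
    | zero => exact filt_zero _
    | succ n ih => rw [pow_succ]; exact mul_mem_filt ih hf
  obtain ⟨g, hg⟩ := exists_limit (fun n => ∑ i ∈ range n, f ^ i) fun n => by
    rw [sum_range_succ, add_sub_cancel_left]; exact hpow n
  refine ⟨g, ?_, ?_⟩
  · refine sub_eq_zero.1 (eq_zero_of_forall_mem_filt fun n => ?_)
    have h1 := mul_mem_filt_right (1 - f) (hg n)
    have h2 := sub_mem h1 (hpow n)
    rw [mul_sub, mul_neg_geom_sum] at h2
    convert h2 using 1
    abel
  · refine sub_eq_zero.1 (eq_zero_of_forall_mem_filt fun n => ?_)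
    have h1 := mul_mem_filt_left (hg n) (1 - f)
    have h2 := sub_mem h1 (hpow n)
    rw [sub_mul, geom_sum_mul_neg] at h2
    convert h2 using 1
    abel

theorem isUnit_of_coeff_nil_ne_zero {f : NCSeries K} (hf : f [] ≠ 0) : IsUnit f := by
  have h1 : (1 - (f [])⁻¹ • f : NCSeries K) ∈ filt 1 := by
    rw [mem_filt_one, coeff_sub, coeff_smul, coeff_one, if_pos rfl, inv_mul_cancel₀ hf, sub_self]
  obtain ⟨g, hg, hg'⟩ := exists_mul_eq_one_of_mem_filt h1
  rw [sub_sub_cancel] at hg hg'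
  rw [smul_mul_assoc, ← mul_smul_comm] at hg
  rw [mul_smul_comm, ← smul_mul_assoc] at hg'
  exact ⟨⟨f, _, hg, hg'⟩, rfl⟩

theorem coeff_algebraMap (c : K) (w : List (Fin 2)) :
    algebraMap K (NCSeries K) c w = if w = [] then c else 0 := by
  rw [Algebra.algebraMap_eq_smul_one, coeff_smul, coeff_one]
  split_ifs <;> simp

/-- Otherwise `f - φ f []` has nonzero constant term and is a unit, while its image has constant
term zero and is not. Every algebra endomorphism thus respects the order filtration, so no
continuity has to be assumed. -/
theorem algHom_coeff_nil (φ : NCSeries K →ₐ[K] NCSeries K) (f : NCSeries K) : φ f [] = f [] := by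
  by_contra h
  have h1 : IsUnit (f - algebraMap K _ (φ f [])) := by
    refine isUnit_of_coeff_nil_ne_zero ?_
    rw [coeff_sub, coeff_algebraMap, if_pos rfl]
    exact fun h' => h (sub_eq_zero.1 h').symm
  obtain ⟨u, hu⟩ := h1.map φ
  have h2 : (φ (f - algebraMap K _ (φ f []))) [] = 0 := by
    rw [map_sub, AlgHom.commutes, coeff_sub, coeff_algebraMap, if_pos rfl, sub_self]
  have h3 := congrFun u.mul_inv []
  change (_ * _ : NCSeries K) [] = (1 : NCSeries K) [] at h3
  rw [hu, coeff_mul_nil, h2, zero_mul, coeff_one, if_pos rfl] at h3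
  exact zero_ne_one h3

theorem algHom_letter_mem_filt (φ : NCSeries K →ₐ[K] NCSeries K) (z : Fin 2) :
    φ (letter z) ∈ filt 1 := by
  rw [mem_filt_one, algHom_coeff_nil, letter_nil]

theorem algHom_eq_shift (φ : NCSeries K →ₐ[K] NCSeries K) (f : NCSeries K) :
    φ f = f [] • 1 + ∑ z, φ (letter z) * φ (shift z f) := by
  conv_lhs => rw [eq_shift f]
  simp

theorem algHom_mem_filt (φ : NCSeries K →ₐ[K] NCSeries K) {n : ℕ} {f : NCSeries K}
    (hf : f ∈ filt n) : φ f ∈ filt n := by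
  induction n generalizing f with
  | zero => exact filt_zero _
  | succ n ih =>
    rw [algHom_eq_shift, (filt_succ.1 hf).1, zero_smul, zero_add]
    refine sum_mem fun z _ => ?_
    rw [add_comm]
    exact mul_mem_filt (algHom_letter_mem_filt φ z) (ih ((filt_succ.1 hf).2 z))

/-- A function satisfying a homogeneous left recursion vanishes. -/
theorem eq_zero_of_recursion {a : Fin 2 → NCSeries K} (ha : ∀ z, a z ∈ filt 1)
    (E : NCSeries K → NCSeries K) (hE : ∀ f, E f = ∑ z, a z * E (shift z f)) (f : NCSeries K) :
    E f = 0 := by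
  refine eq_zero_of_forall_mem_filt fun n => ?_
  induction n generalizing f with
  | zero => exact filt_zero _
  | succ n ih =>
    rw [hE, add_comm]
    exact sum_mem fun z _ => mul_mem_filt (ha z) (ih _)

/-- A function of two series satisfying a homogeneous cyclic recursion vanishes. -/
theorem eq_zero_of_cyclic_recursion (E : NCSeries K → NCSeries K → NCSeries K)
    (hE : ∀ f P, E f P = ∑ z, E (shift z f) (P * letter z))
    (hord : ∀ n f P, P ∈ filt n → E f P ∈ filt n) (f P : NCSeries K) : E f P = 0 := by
  refine eq_zero_of_forall_mem_filt fun n => ?_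
  -- Each use of the recursion appends a letter to `P`, so the order of `P`, and by `hord` that of
  -- `E f P`, passes every bound.
  suffices h : ∀ n q f P, P ∈ filt q → E f P ∈ filt (q + n) by
    simpa using h n 0 f P (filt_zero P)
  intro n
  induction n with
  | zero => exact fun q f P hP => hord q f P hP
  | succ n ih =>
    intro q f P hP
    rw [hE, add_comm n, ← add_assoc]
    exact sum_mem fun z _ => ih _ _ _ (mul_mem_filt hP (letter_mem_filt z))

end

/-! ### Cyclic derivatives: product rule, chain rule, and their common kernel. -/

section

open Finset

variable {K : Type*} [Field K]

/-- The part of a series after an initial word. -/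
def shiftWord (u : List (Fin 2)) (f : NCSeries K) : NCSeries K := fun w => f (u ++ w)

/-- The cyclic derivative with a factor inserted at the end: the continuous bilinear map that
sends a word `w` and a series `P` to the sum of all `v * P * u` with `w = u ++ j :: v`. -/
def cycDer (j : Fin 2) (f P : NCSeries K) : NCSeries K :=
  fun w => ∑ i ∈ range (w.length + 1), (shiftWord (w.drop i ++ [j]) f * P : NCSeries K) (w.take i)

theorem coeff_cycDer (j : Fin 2) (f P : NCSeries K) (w : List (Fin 2)) :
    cycDer j f P w = ∑ i ∈ range (w.length + 1),
      (shiftWord (w.drop i ++ [j]) f * P : NCSeries K) (w.take i) := rfl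

theorem cycDer_one_right (j : Fin 2) (f : NCSeries K) : cycDer j f 1 = cyclicDeriv j f := by
  ext w
  rw [coeff_cycDer]
  refine sum_congr rfl fun i _ => ?_
  rw [mul_one, shiftWord, List.append_assoc, List.singleton_append]

theorem cycDer_add_left (j : Fin 2) (f g P : NCSeries K) :
    cycDer j (f + g) P = cycDer j f P + cycDer j g P := by
  ext w
  rw [coeff_add, coeff_cycDer, coeff_cycDer, coeff_cycDer, ← sum_add_distrib]
  refine sum_congr rfl fun i _ => ?_
  rw [← coeff_add, ← add_mul]; rfl

theorem cycDer_smul_left (j : Fin 2) (c : K) (f P : NCSeries K) :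
    cycDer j (c • f) P = c • cycDer j f P := by
  ext w
  rw [coeff_smul, coeff_cycDer, coeff_cycDer, mul_sum]
  refine sum_congr rfl fun i _ => ?_
  rw [← coeff_smul, ← smul_mul_assoc]; rfl

theorem cycDer_add_right (j : Fin 2) (f P Q : NCSeries K) :
    cycDer j f (P + Q) = cycDer j f P + cycDer j f Q := by
  ext w
  rw [coeff_add, coeff_cycDer, coeff_cycDer, coeff_cycDer, ← sum_add_distrib]
  refine sum_congr rfl fun i _ => ?_
  rw [← coeff_add, ← mul_add]

theorem cycDer_smul_right (j : Fin 2) (c : K) (f P : NCSeries K) :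
    cycDer j f (c • P) = c • cycDer j f P := by
  ext w
  rw [coeff_smul, coeff_cycDer, coeff_cycDer, mul_sum]
  refine sum_congr rfl fun i _ => ?_
  rw [← coeff_smul, mul_smul_comm]

/-- `cycDer` as a bilinear map. -/
def cycDerₗ (j : Fin 2) : NCSeries K →ₗ[K] NCSeries K →ₗ[K] NCSeries K :=
  LinearMap.mk₂ K (cycDer j) (cycDer_add_left j) (cycDer_smul_left j) (cycDer_add_right j)
    (cycDer_smul_right j)

theorem cycDerₗ_apply (j : Fin 2) (f P : NCSeries K) : cycDerₗ j f P = cycDer j f P := rfl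

theorem shiftWord_one (j : Fin 2) (u : List (Fin 2)) :
    shiftWord (u ++ [j]) (1 : NCSeries K) = 0 := by
  ext w; simp [shiftWord, coeff_one, coeff_zero]

theorem cycDer_one_left (j : Fin 2) (P : NCSeries K) : cycDer j 1 P = 0 := by
  ext w
  rw [coeff_cycDer, coeff_zero]
  exact sum_eq_zero fun i _ => by rw [shiftWord_one, zero_mul, coeff_zero]

/-- Either the deleted letter is the first one, or the first letter `z` stays and ends up behind the
insertion `P`. The identities below for `cycDer` are checked through this recursion, since a series
has no length to induct on. -/
theorem cycDer_recursion (j : Fin 2) (f P : NCSeries K) :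
    cycDer j f P = shift j f * P + ∑ z, cycDer j (shift z f) (P * letter z) := by
  ext w
  rw [coeff_add, coeff_sum, coeff_cycDer, sum_range_succ, add_comm]
  congr 1
  · rw [List.drop_length, List.take_length]; rfl
  · simp_rw [coeff_cycDer, sum_range_succ' _ w.length]
    rw [sum_add_distrib, sum_comm]
    have h0 : ∀ (i : Fin 2), (shiftWord (w.drop 0 ++ [j]) (shift i f) * (P * letter i) : NCSeries K)
        (w.take 0) = 0 := fun i => by
      rw [← mul_assoc, List.take_zero, coeff_mul_letter_nil]
    rw [sum_eq_zero fun i _ => h0 i, add_zero]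
    refine sum_congr rfl fun i hi => ?_
    rw [mem_range] at hi
    have h1 : w.drop i = w[i] :: w.drop (i + 1) := List.drop_eq_getElem_cons hi
    have h2 : w.take (i + 1) = w.take i ++ [w[i]] := by simp
    simp_rw [h2, ← mul_assoc, coeff_mul_letter]
    rw [sum_ite_eq, if_pos (mem_univ _), h1]
    rfl

theorem cycDer_mem_filt (j : Fin 2) (f : NCSeries K) {P : NCSeries K} {n : ℕ} (hP : P ∈ filt n) :
    cycDer j f P ∈ filt n := by
  intro w hw
  refine sum_eq_zero fun i _ => ?_
  refine mul_mem_filt_right _ hP _ ?_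
  rw [List.length_take]
  omega

theorem cycDer_mem_filt_of_left (j : Fin 2) {f : NCSeries K} (P : NCSeries K) {n : ℕ}
    (hf : f ∈ filt (n + 1)) : cycDer j f P ∈ filt n := by
  intro w hw
  refine sum_eq_zero fun i hi => ?_
  rw [mem_range] at hi
  refine mul_mem_filt_left (m := i + 1) (fun v hv => hf _ ?_) P _ ?_
  · simp only [List.length_append, List.length_drop, List.length_singleton]
    omega
  · rw [List.length_take]
    omega

theorem cycDer_letter (j z : Fin 2) (P : NCSeries K) :
    cycDer j (letter z) P = if j = z then P else 0 := by
  rw [cycDer_recursion, shift_letter]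
  have : ∀ z', cycDer j (shift z' (letter z)) (P * letter z' : NCSeries K) = 0 := fun z' => by
    rw [shift_letter]
    split_ifs
    · exact cycDer_one_left _ _
    · exact (congrArg (fun L : _ →ₗ[K] _ => L (P * letter z')) (map_zero (cycDerₗ j)))
  rw [sum_eq_zero fun z' _ => this z', add_zero]
  split_ifs <;> simp

/-- When a letter of `f` is deleted, `g` belongs to the rest of the cyclic word, and vice versa. The
slot `P` stores that rest, which is why this rule closes up while `cyclicDeriv` alone has no product
rule. -/
theorem cycDer_mul (j : Fin 2) (f g P : NCSeries K) :
    cycDer j (f * g) P = cycDer j f (g * P) + cycDer j g (P * f) := by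
  refine sub_eq_zero.1 (eq_zero_of_cyclic_recursion
    (fun f P => cycDer j (f * g) P - (cycDer j f (g * P) + cycDer j g (P * f))) ?_ ?_ f P)
  · intro f P
    have h1 : ∀ z, cycDer j (shift z (f * g)) (P * letter z) =
        f [] • cycDer j (shift z g) (P * letter z) + cycDer j (shift z f * g) (P * letter z) := by
      intro z
      rw [shift_mul, cycDer_add_left, cycDer_smul_left]
    have h2 : cycDer j g (P * f) = f [] • cycDer j g P +
        ∑ z, cycDer j g (P * letter z * shift z f) := by
      conv_lhs => rw [eq_shift f, mul_add, mul_smul_comm, mul_one, mul_sum]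
      simp only [← cycDerₗ_apply, map_add, map_sum, map_smul, mul_assoc]
    rw [h2, cycDer_recursion j (f * g), cycDer_recursion j f, cycDer_recursion j g P,
      sum_congr rfl fun z _ => h1 z, shift_mul]
    simp only [sum_add_distrib, sum_sub_distrib, add_mul, smul_add, ← smul_sum, smul_mul_assoc,
      mul_assoc]
    abel
  · intro n f P hP
    exact sub_mem (cycDer_mem_filt _ _ hP) (add_mem (cycDer_mem_filt _ _ (mul_mem_filt_right _ hP))
      (cycDer_mem_filt _ _ (mul_mem_filt_left hP _)))

theorem cycDer_algHom (φ : NCSeries K →ₐ[K] NCSeries K) (j : Fin 2) (f P : NCSeries K) :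
    cycDer j (φ f) (φ P) = ∑ z, cycDer j (φ (letter z)) (φ (cycDer z f P)) := by
  refine sub_eq_zero.1 (eq_zero_of_cyclic_recursion
    (fun f P => cycDer j (φ f) (φ P) - ∑ z, cycDer j (φ (letter z)) (φ (cycDer z f P))) ?_ ?_ f P)
  · intro f P
    have h1 : cycDer j (φ f) (φ P) = ∑ z, (cycDer j (φ (letter z)) (φ (shift z f * P)) +
        cycDer j (φ (shift z f)) (φ (P * letter z))) := by
      rw [algHom_eq_shift φ f, cycDer_add_left, cycDer_smul_left, cycDer_one_left, smul_zero,
        zero_add, ← cycDerₗ_apply, map_sum, LinearMap.sum_apply]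
      refine sum_congr rfl fun z _ => ?_
      rw [cycDerₗ_apply, cycDer_mul, map_mul, map_mul]
    have h2 : ∀ z, cycDer j (φ (letter z)) (φ (cycDer z f P)) =
        cycDer j (φ (letter z)) (φ (shift z f * P)) +
        ∑ z', cycDer j (φ (letter z)) (φ (cycDer z (shift z' f) (P * letter z'))) := by
      intro z
      rw [cycDer_recursion z f]
      simp only [← cycDerₗ_apply, map_add, map_sum]
    rw [h1, sum_congr rfl fun z _ => h2 z, sum_sub_distrib, sum_add_distrib, sum_add_distrib,
      sum_comm (γ := Fin 2)]
    abel
  · intro n f P hP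
    exact sub_mem (cycDer_mem_filt _ _ (algHom_mem_filt φ hP))
      (sum_mem fun z _ => cycDer_mem_filt _ _ (algHom_mem_filt φ (cycDer_mem_filt _ _ hP)))

theorem cyclicDeriv_algHom (φ : NCSeries K →ₐ[K] NCSeries K) (j : Fin 2) (f : NCSeries K) :
    cyclicDeriv j (φ f) = ∑ z, cycDer j (φ (letter z)) (φ (cyclicDeriv z f)) := by
  have := cycDer_algHom φ j f 1
  simpa only [map_one, cycDer_one_right] using this

theorem cyclicDeriv_mul (j : Fin 2) (f g : NCSeries K) :
    cyclicDeriv j (f * g) = cycDer j f g + cycDer j g f := by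
  rw [← cycDer_one_right, cycDer_mul, mul_one, one_mul]

/-- The cyclic derivative as a linear map. -/
def cyclicDerivₗ (j : Fin 2) : NCSeries K →ₗ[K] NCSeries K := (cycDerₗ j).flip 1

theorem cyclicDerivₗ_apply (j : Fin 2) (f : NCSeries K) : cyclicDerivₗ j f = cyclicDeriv j f :=
  cycDer_one_right j f

theorem cyclicDeriv_mem_filt (j : Fin 2) {f : NCSeries K} {n : ℕ} (hf : f ∈ filt (n + 1)) :
    cyclicDeriv j f ∈ filt n := by
  rw [← cycDer_one_right]
  exact cycDer_mem_filt_of_left j 1 hf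

variable (K) in
/-- The linear span of commutators. -/
def commSpan : Submodule K (NCSeries K) :=
  Submodule.span K {c : NCSeries K | ∃ a b : NCSeries K, c = a * b - b * a}

theorem comm_mem_commSpan (a b : NCSeries K) : a * b - b * a ∈ commSpan K :=
  Submodule.subset_span ⟨a, b, rfl⟩

theorem cyclicDeriv_eq_zero_of_mem_commSpan {f : NCSeries K} (hf : f ∈ commSpan K) (j : Fin 2) :
    cyclicDeriv j f = 0 := by
  suffices h : commSpan K ≤ LinearMap.ker (cyclicDerivₗ j) by
    simpa [cyclicDerivₗ_apply] using h hf
  refine Submodule.span_le.2 ?_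
  rintro _ ⟨a, b, rfl⟩
  rw [SetLike.mem_coe, LinearMap.mem_ker, map_sub, cyclicDerivₗ_apply, cyclicDerivₗ_apply,
    cyclicDeriv_mul, cyclicDeriv_mul, add_comm, sub_self]

theorem coeff_nil_of_mem_commSpan {f : NCSeries K} (hf : f ∈ commSpan K) : f [] = 0 := by
  suffices h : commSpan K ≤ LinearMap.ker (constCoeff (K := K)) from h hf
  refine Submodule.span_le.2 ?_
  rintro _ ⟨a, b, rfl⟩
  rw [SetLike.mem_coe, LinearMap.mem_ker, constCoeff_apply, coeff_sub, coeff_mul_nil, coeff_mul_nil,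
    mul_comm, sub_self]

/-- Vanishing derivatives say that the coefficients of `f` sum to zero over the rotations of each
word. Such an `f` is a difference `c(rotated word) - c(word)`, and this is a sum of two commutators,
one for each letter. -/
theorem mem_commSpan_of_cyclicDeriv_eq_zero [CharZero K] {f : NCSeries K} (h0 : f [] = 0)
    (h : ∀ j, cyclicDeriv j f = 0) : f ∈ commSpan K := by
  have hcyc : ∀ w : List (Fin 2), ∑ i ∈ range w.length, f (w.rotate (i + 1)) = 0 := by
    intro w
    cases w with
    | nil => simp
    | cons j u =>
      have := congrFun (h j) u
      rw [cyclicDeriv, coeff_zero] at this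
      rw [← this, List.length_cons]
      refine sum_congr rfl fun i hi => ?_
      rw [mem_range] at hi
      rw [List.rotate_cons_succ, List.rotate_eq_drop_append_take (by simp; omega),
        List.drop_append_of_le_length (by omega), List.take_append_of_le_length (by omega)]
      simp
  -- Weighting the `i`-th rotation by `i` turns the rotation difference into a telescoping sum. What
  -- is left over is a full rotation sum, zero by `hcyc`, and a boundary term `w.length * f
  -- (w.rotate 1)`; characteristic zero allows division by the length.
  set c : List (Fin 2) → K := fun w =>
    (w.length : K)⁻¹ * ∑ i ∈ range w.length, (i : K) * f (w.rotate (i + 1)) with hc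
  have hrot : ∀ w, c (w.rotate 1) - c w = f (w.rotate 1) := by
    intro w
    rcases Nat.eq_zero_or_pos w.length with hw | hw
    · rw [List.length_eq_zero_iff] at hw
      subst hw
      simp [h0]
    have hw' : (w.length : K) ≠ 0 := Nat.cast_ne_zero.2 hw.ne'
    simp only [hc, List.length_rotate, List.rotate_rotate]
    rw [← mul_sub, inv_mul_eq_iff_eq_mul₀ hw']
    have h1 : ∑ i ∈ range w.length, (i : K) * f (w.rotate (1 + (i + 1))) =
        ∑ i ∈ range w.length, ((i + 1 : ℕ) : K) * f (w.rotate ((i + 1) + 1)) -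
        ∑ i ∈ range w.length, f (w.rotate ((i + 1) + 1)) := by
      rw [← sum_sub_distrib]
      refine sum_congr rfl fun i _ => ?_
      rw [add_comm 1]; push_cast; ring
    have h2 := sum_range_succ (fun i => (i : K) * f (w.rotate (i + 1))) w.length
    rw [sum_range_succ'] at h2
    have h3 : ∑ i ∈ range w.length, f (w.rotate ((i + 1) + 1)) = 0 := by
      rw [← hcyc (w.rotate 1), List.length_rotate]
      refine sum_congr rfl fun i _ => ?_
      rw [List.rotate_rotate, add_comm 1]
    have h4 : w.rotate (w.length + 1) = w.rotate 1 := by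
      rw [← List.rotate_rotate, List.rotate_length]
    rw [h1, h3, sub_zero, ← h4]
    simp only [Nat.cast_zero, zero_mul, add_zero] at h2
    rw [h2]; ring
  set d : Fin 2 → NCSeries K := fun z u => c (z :: u) with hd
  have key : f = ∑ z, (letter z * d z - d z * letter z) := by
    ext w
    rw [coeff_sum]
    simp_rw [coeff_sub]
    rcases w.eq_nil_or_concat with rfl | ⟨v, b, rfl⟩
    · simp [coeff_mul_nil, letter_nil, h0]
    rw [sum_sub_distrib]
    have e1 : ∑ z, (d z * letter z : NCSeries K) (v ++ [b]) = c (b :: v) := by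
      simp_rw [coeff_mul_letter]
      rw [sum_ite_eq, if_pos (mem_univ _)]
    have e2 : ∀ u : List (Fin 2), u ≠ [] →
        ∑ z, (letter z * d z : NCSeries K) u = c u := by
      intro u hu
      obtain ⟨a, u', rfl⟩ := List.exists_cons_of_ne_nil hu
      have h1 : ∀ z, (letter z * d z : NCSeries K) (a :: u') =
          (if a = z then d z else 0 : NCSeries K) u' := fun z => by
        rw [← shift_letter_mul, coeff_shift]
      rw [sum_congr rfl fun z _ => h1 z, sum_eq_single a (fun z _ hz => by rw [if_neg hz.symm, coeff_zero]) (by simp), if_pos rfl]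
    have := hrot (b :: v)
    rw [List.rotate_cons_succ, List.rotate_zero] at this
    rw [List.concat_eq_append, e2 _ (by simp), e1, this]
  rw [key]
  exact sum_mem fun z _ => comm_mem_commSpan _ _

/-- The algebraic span of commutators is closed: it is cut out by the constant term and the cyclic
derivatives, which are continuous. This permits passage to limits of changes of variables. -/
theorem mem_commSpan_of_forall_add_filt [CharZero K] {f : NCSeries K}
    (h : ∀ n, ∃ g ∈ filt n, f - g ∈ commSpan K) : f ∈ commSpan K := by
  refine mem_commSpan_of_cyclicDeriv_eq_zero ?_ fun j => eq_zero_of_forall_mem_filt fun n => ?_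
  · obtain ⟨g, hg, hfg⟩ := h 1
    have := coeff_nil_of_mem_commSpan hfg
    rwa [coeff_sub, mem_filt_one.1 hg, sub_zero] at this
  · obtain ⟨g, hg, hfg⟩ := h (n + 1)
    have := cyclicDeriv_eq_zero_of_mem_commSpan hfg j
    rw [← cyclicDerivₗ_apply, map_sub, cyclicDerivₗ_apply, cyclicDerivₗ_apply, sub_eq_zero] at this
    rw [this]
    exact cyclicDeriv_mem_filt j hg

theorem cyclicDeriv_congr {F G : NCSeries K} (h : CycEquiv F G) (j : Fin 2) :
    cyclicDeriv j F = cyclicDeriv j G := by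
  have := cyclicDeriv_eq_zero_of_mem_commSpan h j
  rwa [← cyclicDerivₗ_apply, map_sub, sub_eq_zero, cyclicDerivₗ_apply, cyclicDerivₗ_apply] at this

end

/-! ### Substitutions and automorphisms tangent to the identity. -/

section

open Finset

variable {K : Type*} [Field K]

section Evaluation

variable {V : Type*} [AddCommGroup V] [Module K V]

/-- The value of the part of a series of degree less than `n`, when the letters act on a vector
space by `T` and the empty word is evaluated to `e`. -/
def evalTrunc (T : Fin 2 → V →ₗ[K] V) (e : V) : ℕ → NCSeries K →ₗ[K] V
  | 0 => 0
  | n + 1 => constCoeff.smulRight e + ∑ z, T z ∘ₗ evalTrunc T e n ∘ₗ shift z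

theorem evalTrunc_succ (T : Fin 2 → V →ₗ[K] V) (e : V) (n : ℕ) (f : NCSeries K) :
    evalTrunc T e (n + 1) f = f [] • e + ∑ z, T z (evalTrunc T e n (shift z f)) := by
  simp [evalTrunc, constCoeff_apply]

theorem evalTrunc_succ_sub_mem (T : Fin 2 → V →ₗ[K] V) (e : V) (S : ℕ → Submodule K V)
    (h0 : S 0 = ⊤) (hS : ∀ n z v, v ∈ S n → T z v ∈ S (n + 1)) (n : ℕ) (f : NCSeries K) :
    evalTrunc T e (n + 1) f - evalTrunc T e n f ∈ S n := by
  induction n generalizing f with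
  | zero => rw [h0]; trivial
  | succ n ih =>
    rw [evalTrunc_succ _ _ (n + 1), evalTrunc_succ _ _ n, add_sub_add_left_eq_sub,
      ← sum_sub_distrib]
    refine sum_mem fun z _ => ?_
    rw [← map_sub]
    exact hS _ _ _ (ih _)

end Evaluation

section Substitution

variable (a : Fin 2 → NCSeries K)

/-- Substitution of the series `a z` for the letters `z`, truncated. -/
def substTrunc (n : ℕ) : NCSeries K →ₗ[K] NCSeries K :=
  evalTrunc (fun z => LinearMap.mulLeft K (a z)) 1 n

/-- Substitution of the series `a z` for the letters `z`, as a linear map. -/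
def substₗ : NCSeries K →ₗ[K] NCSeries K where
  toFun f w := substTrunc a (w.length + 1) f w
  map_add' f g := by ext w; rw [map_add]; rfl
  map_smul' c f := by ext w; rw [map_smul]; rfl

variable {a}

theorem substₗ_sub_mem_filt (ha : ∀ z, a z ∈ filt 1) (n : ℕ) (f : NCSeries K) :
    substₗ a f - substTrunc a n f ∈ filt n := by
  have h1 : ∀ n, substTrunc a (n + 1) f - substTrunc a n f ∈ filt n := fun n =>
    evalTrunc_succ_sub_mem _ _ filt (eq_top_iff.2 fun f _ => filt_zero f)
      (fun n z v hv => by rw [add_comm]; exact mul_mem_filt (ha z) hv) n f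
  obtain ⟨g, hg⟩ := exists_limit (fun n => substTrunc a n f) h1
  have : substₗ a f = g := by
    ext w
    exact (sub_eq_zero.1 (hg (w.length + 1) w (Nat.lt_succ_self _))).symm
  rw [this]
  exact hg n

theorem substₗ_eq_shift (ha : ∀ z, a z ∈ filt 1) (f : NCSeries K) :
    substₗ a f = f [] • 1 + ∑ z, a z * substₗ a (shift z f) := by
  refine sub_eq_zero.1 (eq_zero_of_forall_mem_filt fun n => ?_)
  have h1 := filt_mono (Nat.le_succ n) (substₗ_sub_mem_filt ha (n + 1) f)
  have h2 : ∑ z, a z * (substₗ a (shift z f) - substTrunc a n (shift z f)) ∈ filt n :=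
    sum_mem fun z _ => mul_mem_filt_right _ (substₗ_sub_mem_filt ha n _)
  convert sub_mem h1 h2 using 1
  rw [substTrunc, evalTrunc_succ]
  simp only [mul_sub, sum_sub_distrib, LinearMap.mulLeft_apply, substTrunc]
  abel

theorem substₗ_one (ha : ∀ z, a z ∈ filt 1) : substₗ a 1 = 1 := by
  rw [substₗ_eq_shift ha]
  simp [shift_one, coeff_one]

theorem substₗ_mul (ha : ∀ z, a z ∈ filt 1) (f g : NCSeries K) :
    substₗ a (f * g) = substₗ a f * substₗ a g := by
  refine sub_eq_zero.1 (eq_zero_of_recursion ha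
    (fun f => substₗ a (f * g) - substₗ a f * substₗ a g) (fun f => ?_) f)
  have h1 : substₗ a (f * g) =
      f [] • substₗ a g + ∑ z, a z * substₗ a (shift z f * g) := by
    rw [substₗ_eq_shift ha (f * g), coeff_mul_nil, substₗ_eq_shift ha g]
    simp only [shift_mul, map_add, map_smul, mul_add, sum_add_distrib, smul_add, mul_smul_comm,
      smul_sum, ← add_assoc, smul_smul]
  rw [h1, substₗ_eq_shift ha f]
  simp only [mul_sub, sum_sub_distrib, add_mul, sum_mul, smul_mul_assoc, one_mul, mul_assoc]
  abel

/-- Substitution of series without constant coefficient for the letters. -/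
def subst (a : Fin 2 → NCSeries K) (ha : ∀ z, a z ∈ filt 1) : NCSeries K →ₐ[K] NCSeries K :=
  AlgHom.ofLinearMap (substₗ a) (substₗ_one ha) (substₗ_mul ha)

theorem subst_letter (ha : ∀ z, a z ∈ filt 1) (z : Fin 2) : subst a ha (letter z) = a z := by
  change substₗ a (letter z) = a z
  rw [substₗ_eq_shift ha, letter_nil, zero_smul, zero_add]
  rw [sum_eq_single z (fun b _ hb => by rw [shift_letter, if_neg hb, map_zero, mul_zero]) (by simp),
    shift_letter, if_pos rfl, substₗ_one ha, mul_one]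

end Substitution

theorem algHom_sub_mem_filt {φ ψ : NCSeries K →ₐ[K] NCSeries K} {s : ℕ}
    (h : ∀ z, φ (letter z) - ψ (letter z) ∈ filt s) {k : ℕ} {f : NCSeries K} (hf : f ∈ filt k) :
    φ f - ψ f ∈ filt (s + (k - 1)) := by
  -- The cap `n` is the induction variable: it rises by one with each letter peeled off, because `ψ
  -- (letter z)` has order at least one.
  suffices H : ∀ n k f, f ∈ filt k → φ f - ψ f ∈ filt (min n (s + (k - 1))) by
    have := H (s + (k - 1)) k f hf
    rwa [min_self] at this
  intro n
  induction n with
  | zero => intro k f _; rw [Nat.zero_min]; exact filt_zero _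
  | succ n ih =>
    intro k f hf
    have : φ f - ψ f = ∑ z, ((φ (letter z) - ψ (letter z)) * φ (shift z f) +
        ψ (letter z) * (φ (shift z f) - ψ (shift z f))) := by
      rw [algHom_eq_shift φ f, algHom_eq_shift ψ f, add_sub_add_left_eq_sub, ← sum_sub_distrib]
      refine sum_congr rfl fun z _ => ?_
      noncomm_ring
    rw [this]
    refine sum_mem fun z _ => add_mem ?_ ?_
    · exact filt_mono (min_le_right _ _)
        (mul_mem_filt (h z) (algHom_mem_filt φ (shift_mem_filt hf z)))
    · refine filt_mono ?_ (mul_mem_filt (algHom_letter_mem_filt ψ z) (ih _ _ (shift_mem_filt hf z)))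
      omega

/-- An endomorphism is tangent to the identity if it changes the letters by series of order at
least two. -/
def IsTangent (φ : NCSeries K →ₐ[K] NCSeries K) : Prop := ∀ z, φ (letter z) - letter z ∈ filt 2

theorem algHom_sub_self_mem_filt {φ : NCSeries K →ₐ[K] NCSeries K} {s : ℕ}
    (h : ∀ z, φ (letter z) - letter z ∈ filt s) {k : ℕ} {f : NCSeries K} (hf : f ∈ filt k) :
    φ f - f ∈ filt (s + (k - 1)) :=
  algHom_sub_mem_filt (ψ := AlgHom.id K _) h hf

theorem IsTangent.comp {φ ψ : NCSeries K →ₐ[K] NCSeries K} (hφ : IsTangent φ) (hψ : IsTangent ψ) :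
    IsTangent (φ.comp ψ) := by
  intro z
  have := add_mem (algHom_mem_filt φ (hψ z)) (hφ z)
  rwa [map_sub, sub_add_sub_cancel] at this

/-- Since `f - φ f` has larger order than `f`, the kernel is zero and the iteration `v ↦ v + (g - φ
v)` converges to a preimage of `g`. -/
theorem IsTangent.bijective {φ : NCSeries K →ₐ[K] NCSeries K} (hφ : IsTangent φ) :
    Function.Bijective φ := by
  have hsub : ∀ n f, f ∈ filt n → f - φ f ∈ filt (n + 1) := fun n f hf => by
    rw [← neg_sub]
    exact neg_mem (filt_mono (by omega) (algHom_sub_self_mem_filt hφ hf))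
  constructor
  · refine (injective_iff_map_eq_zero φ).2 fun f hf => eq_zero_of_forall_mem_filt fun n => ?_
    induction n with
    | zero => exact filt_zero _
    | succ n ih =>
      have := hsub n f ih
      rwa [hf, sub_zero] at this
  · intro g
    set u : ℕ → NCSeries K := fun n => Nat.rec 0 (fun _ v => v + (g - φ v)) n with hu
    have hsucc : ∀ n, u (n + 1) = u n + (g - φ (u n)) := fun n => rfl
    have hmem : ∀ n, g - φ (u n) ∈ filt n := by
      intro n
      induction n with
      | zero => exact filt_zero _
      | succ n ih =>
        have := hsub n _ ih
        rw [hsucc, map_add]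
        convert this using 1
        abel
    obtain ⟨f, hf⟩ := exists_limit u fun n => by rw [hsucc, add_sub_cancel_left]; exact hmem n
    refine ⟨f, (sub_eq_zero.1 (eq_zero_of_forall_mem_filt fun n => ?_)).symm⟩
    have := sub_mem (hmem n) (algHom_mem_filt φ (hf n))
    rwa [map_sub, sub_sub_sub_cancel_right] at this

/-- The automorphism given by an endomorphism tangent to the identity. -/
def IsTangent.equiv {φ : NCSeries K →ₐ[K] NCSeries K} (hφ : IsTangent φ) :
    NCSeries K ≃ₐ[K] NCSeries K := AlgEquiv.ofBijective φ hφ.bijective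

theorem IsTangent.equiv_apply {φ : NCSeries K →ₐ[K] NCSeries K} (hφ : IsTangent φ)
    (f : NCSeries K) : hφ.equiv f = φ f := rfl

/-- Let `α` send `x` to `φ x` and fix `y`. Then `α⁻¹φ` fixes `x`, so `φ = α(α⁻¹φ)` is a product of
two elementary changes. -/
theorem IsTangent.equiv_mem_closure {φ : NCSeries K →ₐ[K] NCSeries K} (hφ : IsTangent φ) :
    hφ.equiv ∈ Submonoid.closure {ψ : NCSeries K ≃ₐ[K] NCSeries K | IsElementaryChange ψ} := by
  set a : Fin 2 → NCSeries K := ![φ x, y] with ha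
  have ha1 : ∀ z, a z ∈ filt 1 := by
    intro z
    fin_cases z
    · exact algHom_letter_mem_filt φ 0
    · exact letter_mem_filt 1
  have hα : IsTangent (subst a ha1) := by
    intro z
    rw [subst_letter]
    fin_cases z
    · exact hφ 0
    · simp [ha, letter_one]
  have hx : hα.equiv x = φ x := subst_letter ha1 0
  have hy : hα.equiv y = y := subst_letter ha1 1
  have h : hφ.equiv = hα.equiv * (hα.equiv.symm * hφ.equiv) := by
    ext1 f
    simp [AlgEquiv.mul_apply]
  rw [h]
  refine mul_mem (Submonoid.subset_closure (Or.inr ⟨hy, ?_⟩))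
    (Submonoid.subset_closure (Or.inl ⟨?_, ?_⟩))
  · rw [hx]; exact hφ 0
  · rw [AlgEquiv.mul_apply, IsTangent.equiv_apply, ← hx, AlgEquiv.symm_apply_apply]
  · have h1 : hα.equiv.symm y = y := by rw [AlgEquiv.symm_apply_eq, hy]
    have := algHom_mem_filt (hα.equiv.symm : NCSeries K →ₐ[K] NCSeries K) (hφ 1)
    rw [map_sub] at this
    rw [AlgEquiv.mul_apply, IsTangent.equiv_apply]
    nth_rewrite 2 [← h1]
    exact this

end

/-! ### Nakayama's lemma and invariance of the Jacobian ideal. -/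

section

open Finset

variable {K : Type*} [Field K]

variable (K) in
-- The generators are the finitely many words of length `N`, and the coefficients are the tails
-- behind them.
theorem exists_generators_filt (N : ℕ) : ∃ (ι : Type) (_ : Fintype ι) (s : ι → NCSeries K),
    (∀ i, s i ∈ filt N) ∧ ∀ M f, f ∈ filt (N + M) →
      ∃ c : ι → NCSeries K, (∀ i, c i ∈ filt M) ∧ f = ∑ i, s i * c i := by
  induction N with
  | zero =>
    refine ⟨Unit, inferInstance, fun _ => 1, fun _ => filt_zero _, fun M f hf => ?_⟩
    exact ⟨fun _ => f, fun _ => by simpa using hf, by simp⟩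
  | succ N ih =>
    obtain ⟨ι, _, s, hs, h⟩ := ih
    refine ⟨Fin 2 × ι, inferInstance, fun p => letter p.1 * s p.2, fun p => ?_, fun M f hf => ?_⟩
    · rw [add_comm]
      exact mul_mem_filt (letter_mem_filt _) (hs _)
    · rw [add_right_comm] at hf
      choose c hc hfc using fun z => h M _ ((filt_succ.1 hf).2 z)
      refine ⟨fun p => c p.1 p.2, fun p => hc _ _, ?_⟩
      rw [Fintype.sum_prod_type]
      conv_lhs => rw [eq_shift f, (filt_succ.1 hf).1, zero_smul, zero_add]
      refine sum_congr rfl fun z _ => ?_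
      conv_lhs => rw [hfc z, mul_sum]
      simp only [mul_assoc]

/-- A form of Nakayama's lemma. -/
theorem filt_le_of_le_add_filt (I : TwoSidedIdeal (NCSeries K)) (N : ℕ)
    (h : ∀ f ∈ filt N, ∃ u ∈ I, f - u ∈ filt (N + 1)) {f : NCSeries K} (hf : f ∈ filt N) :
    f ∈ I := by
  classical
  obtain ⟨ι, _, s, hs, hgen⟩ := exists_generators_filt K N
  -- Nothing makes `I` closed, so limits are not available. Generators are eliminated one at a time:
  -- modulo `I`, `s a` is `s a * e a` plus terms in the remaining generators, with `e a` of order at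
  -- least one, and `1 - e a` is invertible.
  suffices H : ∀ T : Finset ι, (∀ f ∈ filt N, ∃ u ∈ I, ∃ c : ι → NCSeries K,
      f = u + ∑ i ∈ T, s i * c i) → ∀ f ∈ filt N, f ∈ I by
    refine H univ (fun f hf => ⟨0, I.zero_mem, ?_⟩) f hf
    obtain ⟨c, -, hc⟩ := hgen 0 f hf
    exact ⟨c, by rw [zero_add]; exact hc⟩
  intro T
  induction T using Finset.induction_on with
  | empty =>
    intro hT f hf
    obtain ⟨u, hu, c, rfl⟩ := hT f hf
    simpa using hu
  | insert a T ha ih =>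
    intro hT
    refine ih fun f hf => ?_
    choose v hv d hd using fun i => hT (s i) (hs i)
    obtain ⟨u₀, hu₀, hr⟩ := h (s a) (hs a)
    obtain ⟨c, hc, hrc⟩ := hgen 1 _ hr
    set e : ι → NCSeries K := fun j => ∑ i, d i j * c i with he
    set u₁ : NCSeries K := u₀ + ∑ i, v i * c i with hu₁
    have hu₁I : u₁ ∈ I := I.add_mem hu₀ (I.finsetSum_mem _ _ fun i _ => I.mul_mem_right _ _ (hv i))
    have hsa : s a = u₁ + (s a * e a + ∑ j ∈ T, s j * e j) := by
      rw [← sum_insert (f := fun j => s j * e j) ha, hu₁, add_assoc, ← sub_eq_iff_eq_add', hrc]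
      have : ∀ i, s i * c i = v i * c i + ∑ j ∈ insert a T, s j * (d i j * c i) := fun i => by
        conv_lhs => rw [hd i, add_mul, sum_mul]
        simp only [mul_assoc]
      rw [sum_congr rfl fun i _ => this i, sum_add_distrib, sum_comm (s := univ)]
      simp only [he, mul_sum]
    have hea : e a ∈ filt 1 := sum_mem fun i _ => mul_mem_filt_right _ (hc i)
    obtain ⟨g, hg, -⟩ := exists_mul_eq_one_of_mem_filt hea
    have hsa' : s a = u₁ * g + ∑ j ∈ T, s j * (e j * g) := by
      calc s a = s a * ((1 - e a) * g) := by rw [hg, mul_one]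
        _ = (s a - s a * e a) * g := by noncomm_ring
        _ = (u₁ + ∑ j ∈ T, s j * e j) * g := by
          congr 1
          nth_rewrite 1 [hsa]
          abel
        _ = _ := by rw [add_mul, sum_mul]; simp only [mul_assoc]
    obtain ⟨u, hu, c', rfl⟩ := hT f hf
    refine ⟨u + u₁ * g * c' a, I.add_mem hu (I.mul_mem_right _ _ (I.mul_mem_right _ _ hu₁I)),
      fun j => e j * g * c' a + c' j, ?_⟩
    rw [sum_insert ha]
    nth_rewrite 1 [hsa']
    simp only [add_mul, sum_mul, mul_add, sum_add_distrib, mul_assoc]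
    abel

/-- The images of the filtration in the finite-dimensional quotient form a descending chain. Once it
is stationary, the hypothesis of Nakayama's lemma holds. -/
theorem exists_filt_le_of_finite (I : TwoSidedIdeal (NCSeries K))
    [Module.Finite K I.ringCon.Quotient] : ∃ N, ∀ f ∈ filt N, f ∈ I := by
  set π : NCSeries K →ₗ[K] I.ringCon.Quotient := (I.ringCon.mkₐ (α := K)).toLinearMap with hπ
  obtain ⟨N, hN⟩ := IsArtinian.monotone_stabilizes (R := K) (M := I.ringCon.Quotient)
    ⟨fun n => OrderDual.toDual ((filt n).map π), fun m n hmn => by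
      exact Submodule.map_mono fun f hf => filt_mono hmn hf⟩
  refine ⟨N, fun f hf => filt_le_of_le_add_filt I N (fun f hf => ?_) hf⟩
  have h1 : (filt N).map π = (filt (N + 1)).map π := hN (N + 1) (Nat.le_succ N)
  have h2 : π f ∈ (filt (N + 1)).map π := h1 ▸ Submodule.mem_map_of_mem hf
  obtain ⟨g, hg, hgf⟩ := h2
  refine ⟨f - g, ?_, by rwa [sub_sub_cancel]⟩
  rw [← TwoSidedIdeal.rel_iff, ← RingCon.eq]
  exact hgf.symm

/-- The sum of a two-sided ideal and the ideal of series of order at least `n`. -/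
def addFilt (I : TwoSidedIdeal (NCSeries K)) (n : ℕ) : TwoSidedIdeal (NCSeries K) :=
  TwoSidedIdeal.mk' {f | ∃ u ∈ I, f - u ∈ filt n}
    ⟨0, I.zero_mem, by rw [sub_zero]; exact zero_mem _⟩
    (fun ⟨u, hu, h⟩ ⟨v, hv, h'⟩ => ⟨u + v, I.add_mem hu hv, by
      rw [add_sub_add_comm]; exact add_mem h h'⟩)
    (fun ⟨u, hu, h⟩ => ⟨-u, I.neg_mem hu, by rw [← neg_sub']; exact neg_mem h⟩)
    (fun {a _} ⟨u, hu, h⟩ => ⟨a * u, I.mul_mem_left _ _ hu, by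
      rw [← mul_sub]; exact mul_mem_filt_right _ h⟩)
    (fun {_ b} ⟨u, hu, h⟩ => ⟨u * b, I.mul_mem_right _ _ hu, by
      rw [← sub_mul]; exact mul_mem_filt_left h _⟩)

theorem mem_addFilt {I : TwoSidedIdeal (NCSeries K)} {n : ℕ} {f : NCSeries K} :
    f ∈ addFilt I n ↔ ∃ u ∈ I, f - u ∈ filt n := by
  rw [addFilt, TwoSidedIdeal.mem_mk']; rfl

/-- Each term `v * P * u` lies in `I`, but there may be infinitely many, so membership is obtained
only modulo high order. -/
theorem cycDer_mem_addFilt (I : TwoSidedIdeal (NCSeries K)) (j : Fin 2) (n : ℕ) (f : NCSeries K)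
    {P : NCSeries K} (hP : P ∈ I) : cycDer j f P ∈ addFilt I n := by
  suffices H : ∀ n q f P, P ∈ I → P ∈ filt q → cycDer j f P ∈ addFilt I (q + n) by
    simpa using H n 0 f P hP (filt_zero P)
  intro n
  induction n with
  | zero =>
    intro q f P _ hq
    exact mem_addFilt.2 ⟨0, I.zero_mem, by rw [sub_zero]; exact cycDer_mem_filt j f hq⟩
  | succ n ih =>
    intro q f P hP hq
    rw [cycDer_recursion]
    refine TwoSidedIdeal.add_mem _ (mem_addFilt.2 ⟨shift j f * P, I.mul_mem_left _ _ hP, ?_⟩)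
      (TwoSidedIdeal.finsetSum_mem _ _ _ fun z _ => ?_)
    · rw [sub_self]; exact zero_mem _
    · rw [add_comm n, ← add_assoc]
      exact ih _ _ _ (I.mul_mem_right _ _ hP) (mul_mem_filt hq (letter_mem_filt z))

theorem cyclicDeriv_mem_jacobianIdeal (F : NCSeries K) (j : Fin 2) :
    cyclicDeriv j F ∈ jacobianIdeal F := by
  refine TwoSidedIdeal.subset_span ?_
  fin_cases j <;> simp

theorem jacobianIdeal_le {F : NCSeries K} {I : TwoSidedIdeal (NCSeries K)}
    (h : ∀ j, cyclicDeriv j F ∈ I) : jacobianIdeal F ≤ I := by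
  refine TwoSidedIdeal.span_le.2 ?_
  rintro _ (rfl | rfl)
  · exact h 0
  · exact h 1

theorem jacobianIdeal_congr {F G : NCSeries K} (h : CycEquiv F G) :
    jacobianIdeal F = jacobianIdeal G := by
  rw [jacobianIdeal, jacobianIdeal, cyclicDeriv_congr h, cyclicDeriv_congr h]

/-- The chain rule for `φ⁻¹` applied to `φ F` puts the generators into `J` up to any order. By `hN`
the hypothesis of Nakayama's lemma then holds for `J`, so `J` contains the error terms. -/
theorem jacobianIdeal_le_comap {F : NCSeries K} {N : ℕ} (hN : ∀ f ∈ filt N, f ∈ jacobianIdeal F)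
    (φ : NCSeries K ≃ₐ[K] NCSeries K) : jacobianIdeal F ≤ (jacobianIdeal (φ F)).comap φ := by
  set J := (jacobianIdeal (φ F)).comap φ with hJ
  have h1 : ∀ n, jacobianIdeal F ≤ addFilt J n := by
    intro n
    refine jacobianIdeal_le fun j => ?_
    have h := cyclicDeriv_algHom (φ.symm : NCSeries K →ₐ[K] NCSeries K) j (φ F)
    rw [AlgEquiv.coe_toAlgHom, AlgEquiv.symm_apply_apply] at h
    rw [h]
    refine TwoSidedIdeal.finsetSum_mem _ _ _ fun z _ => cycDer_mem_addFilt J _ _ _ ?_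
    rw [hJ, TwoSidedIdeal.mem_comap, AlgEquiv.apply_symm_apply]
    exact cyclicDeriv_mem_jacobianIdeal _ _
  have h2 : ∀ f ∈ filt N, f ∈ J := fun f hf =>
    filt_le_of_le_add_filt J N (fun f hf => mem_addFilt.1 (h1 (N + 1) (hN f hf))) hf
  intro f hf
  obtain ⟨u, hu, hfu⟩ := mem_addFilt.1 (h1 N hf)
  have := J.add_mem (h2 _ hfu) hu
  rwa [sub_add_cancel] at this

theorem filt_le_jacobianIdeal_algEquiv {F : NCSeries K} {N : ℕ}
    (hN : ∀ f ∈ filt N, f ∈ jacobianIdeal F) (φ : NCSeries K ≃ₐ[K] NCSeries K) :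
    ∀ f ∈ filt N, f ∈ jacobianIdeal (φ F) := by
  intro f hf
  have h1 := jacobianIdeal_le_comap hN φ
    (hN _ (algHom_mem_filt (φ.symm : NCSeries K →ₐ[K] NCSeries K) hf))
  rw [TwoSidedIdeal.mem_comap] at h1
  simpa using h1

theorem mem_jacobianIdeal_algEquiv {F : NCSeries K} {N : ℕ}
    (hN : ∀ f ∈ filt N, f ∈ jacobianIdeal F) (φ : NCSeries K ≃ₐ[K] NCSeries K) (f : NCSeries K) :
    φ f ∈ jacobianIdeal (φ F) ↔ f ∈ jacobianIdeal F := by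
  refine ⟨fun h => ?_, fun h => (TwoSidedIdeal.mem_comap φ).1 (jacobianIdeal_le_comap hN φ h)⟩
  have := jacobianIdeal_le_comap (filt_le_jacobianIdeal_algEquiv hN φ) φ.symm h
  rw [TwoSidedIdeal.mem_comap] at this
  simpa using this

theorem nonempty_potentialAlgebra_equiv {F G : NCSeries K}
    [Module.Finite K (PotentialAlgebra F)] (φ : NCSeries K ≃ₐ[K] NCSeries K)
    (h : CycEquiv (φ F) G) : Nonempty (PotentialAlgebra F ≃ₐ[K] PotentialAlgebra G) := by
  obtain ⟨N, hN⟩ := exists_filt_le_of_finite (jacobianIdeal F)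
  refine ⟨RingCon.congrₐ K φ ?_⟩
  ext f g
  rw [RingCon.comap_rel, TwoSidedIdeal.rel_iff, TwoSidedIdeal.rel_iff, ← map_sub,
    ← jacobianIdeal_congr h, mem_jacobianIdeal_algEquiv hN]

end

/-! ### Taylor expansion modulo commutators and finite determinacy. -/

section

open Finset

variable {K : Type*} [Field K]

variable (K) in
/-- Sums of commutators and series of order at least `n`. -/
def commFilt (n : ℕ) : Submodule K (NCSeries K) := commSpan K ⊔ filt n

theorem commSpan_le_commFilt (n : ℕ) : commSpan K ≤ commFilt K n := le_sup_left

theorem filt_le_commFilt (n : ℕ) : filt n ≤ commFilt K n := le_sup_right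

theorem commFilt_mono {m n : ℕ} (h : m ≤ n) : commFilt K n ≤ commFilt K m :=
  sup_le_sup_left (fun _ hf => filt_mono h hf) _

theorem comm_mem_commFilt (n : ℕ) (a b : NCSeries K) : a * b - b * a ∈ commFilt K n :=
  commSpan_le_commFilt n (comm_mem_commSpan a b)

theorem exists_of_mem_commFilt {n : ℕ} {f : NCSeries K} (h : f ∈ commFilt K n) :
    ∃ e ∈ filt n, f - e ∈ commSpan K := by
  obtain ⟨c, hc, e, he, rfl⟩ := Submodule.mem_sup.1 h
  exact ⟨e, he, by rwa [add_sub_cancel_right]⟩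

theorem mem_commSpan_of_forall_mem_commFilt [CharZero K] {f : NCSeries K}
    (h : ∀ n, f ∈ commFilt K n) : f ∈ commSpan K :=
  mem_commSpan_of_forall_add_filt fun n => exists_of_mem_commFilt (h n)

/-- Letters of `f` are replaced one by one and rotated to the back, where `P` collects those already
passed. Apart from commutators, each replacement leaves an error containing two increments, which
accounts for `2 * s`. -/
theorem taylor_mul_mem_commFilt {φ : NCSeries K →ₐ[K] NCSeries K} {s : ℕ} (hs : 1 ≤ s)
    (hφ : ∀ z, φ (letter z) - letter z ∈ filt s) {k q : ℕ} {f P : NCSeries K} (hf : f ∈ filt k)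
    (hP : P ∈ filt q) :
    φ f * P - f * P - ∑ j, cycDer j f P * (φ (letter j) - letter j) ∈
      commFilt K (2 * s + k - 2 + q) := by
  suffices H : ∀ n k q f P, f ∈ filt k → P ∈ filt q →
      φ f * P - f * P - ∑ j, cycDer j f P * (φ (letter j) - letter j) ∈
        commFilt K (min (q + n) (2 * s + k - 2 + q)) by
    have := H (2 * s + k) k q f P hf hP
    rwa [min_eq_right (by omega)] at this
  intro n
  induction n with
  | zero =>
    intro k q f P _ hP
    refine filt_le_commFilt _ (filt_mono (min_le_left _ _) ?_)
    exact sub_mem (sub_mem (mul_mem_filt_right _ hP) (mul_mem_filt_right _ hP))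
      (sum_mem fun j _ => mul_mem_filt_left (cycDer_mem_filt j f hP) _)
  | succ n ih =>
    intro k q f P hf hP
    have key : φ f * P - f * P - ∑ j, cycDer j f P * (φ (letter j) - letter j) =
        ∑ z, ((φ (shift z f) * (P * letter z) - shift z f * (P * letter z) -
          ∑ j, cycDer j (shift z f) (P * letter z) * (φ (letter j) - letter j)) +
        (φ (shift z f) - shift z f) * P * (φ (letter z) - letter z) +
        ((letter z * (φ (shift z f) * P) - (φ (shift z f) * P) * letter z) -
        (letter z * (shift z f * P) - (shift z f * P) * letter z) +
        ((φ (letter z) - letter z) * (φ (shift z f) * P) -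
          (φ (shift z f) * P) * (φ (letter z) - letter z)))) := by
      have h1 : φ f * P - f * P = ∑ z, (φ (letter z) * φ (shift z f) * P -
          letter z * shift z f * P) := by
        rw [algHom_eq_shift φ f]
        nth_rewrite 3 [eq_shift f]
        rw [add_mul, add_mul, add_sub_add_left_eq_sub, sum_mul, sum_mul, sum_sub_distrib]
      have h2 : ∑ j, cycDer j f P * (φ (letter j) - letter j) =
          ∑ z, (shift z f * P * (φ (letter z) - letter z) +
          ∑ j, cycDer j (shift z f) (P * letter z) * (φ (letter j) - letter j)) := by
        rw [sum_add_distrib, sum_comm, ← sum_add_distrib]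
        refine sum_congr rfl fun j _ => ?_
        rw [cycDer_recursion, add_mul, sum_mul]
      rw [h1, h2, ← sum_sub_distrib]
      refine sum_congr rfl fun z _ => ?_
      noncomm_ring
    rw [key]
    refine sum_mem fun z _ => add_mem (add_mem ?_ ?_) (add_mem (sub_mem (comm_mem_commFilt _ _ _)
      (comm_mem_commFilt _ _ _)) (comm_mem_commFilt _ _ _))
    · exact commFilt_mono (by omega) (ih (k - 1) (q + 1) _ _ (shift_mem_filt hf z)
        (mul_mem_filt hP (letter_mem_filt z)))
    · refine filt_le_commFilt _ (filt_mono ?_ (mul_mem_filt (mul_mem_filt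
        (algHom_sub_self_mem_filt hφ (shift_mem_filt hf z)) hP) (hφ z)))
      omega

/-- The first-order Taylor expansion of a potential under a change of variables. -/
theorem taylor_mem_commFilt {g : Fin 2 → NCSeries K} {s : ℕ} (hs : 1 ≤ s)
    (hg : ∀ z, g z ∈ filt s) (h1 : ∀ z, letter z - g z ∈ filt 1) {F : NCSeries K}
    (hF : F ∈ filt 3) :
    subst _ h1 F - F + ∑ j, cyclicDeriv j F * g j ∈ commFilt K (2 * s + 1) := by
  have hφ : ∀ z, subst _ h1 (letter z) - letter z = -g z := fun z => by
    rw [subst_letter]; abel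
  have := taylor_mul_mem_commFilt (φ := subst _ h1) hs
    (fun z => by rw [hφ]; exact neg_mem (hg z)) hF (filt_zero 1)
  rw [show 2 * s + 3 - 2 + 0 = 2 * s + 1 by omega] at this
  simpa only [hφ, mul_one, mul_neg, sum_neg_distrib, sub_neg_eq_add, cycDer_one_right] using this

theorem letter_sub_mem_filt {g : Fin 2 → NCSeries K} {s : ℕ} (hs : 1 ≤ s)
    (hg : ∀ z, g z ∈ filt s) (z : Fin 2) : letter z - g z ∈ filt 1 :=
  sub_mem (letter_mem_filt z) (filt_mono hs (hg z))

theorem isTangent_subst {g : Fin 2 → NCSeries K} (hg : ∀ z, g z ∈ filt 2)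
    (h1 : ∀ z, letter z - g z ∈ filt 1) : IsTangent (subst _ h1) := fun z => by
  rw [subst_letter, sub_sub_cancel_left]
  exact neg_mem (hg z)

/-- Split each word of `h` after `N` letters: the front lies in the ideal and the tail has order
`s`. Modulo commutators a product `a * ∂ * b` of the ideal times the tail `e` becomes `∂ * (b * e *
a)`, keeping the order `s`. -/
theorem exists_cyclic_decomposition {G : NCSeries K} {N : ℕ}
    (hN : ∀ f ∈ filt N, f ∈ jacobianIdeal G) {s : ℕ} {h : NCSeries K} (hh : h ∈ filt (N + s)) :
    ∃ g : Fin 2 → NCSeries K, (∀ j, g j ∈ filt s) ∧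
      h - ∑ j, cyclicDeriv j G * g j ∈ commSpan K := by
  set L : Submodule K (NCSeries K) :=
    { carrier := {h | ∃ g : Fin 2 → NCSeries K, (∀ j, g j ∈ filt s) ∧
        h - ∑ j, cyclicDeriv j G * g j ∈ commSpan K}
      add_mem' := by
        rintro a b ⟨g, hg, ha⟩ ⟨g', hg', hb⟩
        refine ⟨g + g', fun j => add_mem (hg j) (hg' j), ?_⟩
        convert add_mem ha hb using 1
        simp only [Pi.add_apply, mul_add, sum_add_distrib]
        abel
      zero_mem' := ⟨0, fun j => zero_mem _, by simp⟩
      smul_mem' := by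
        rintro c a ⟨g, hg, ha⟩
        refine ⟨c • g, fun j => Submodule.smul_mem _ _ (hg j), ?_⟩
        convert Submodule.smul_mem _ c ha using 1
        simp only [Pi.smul_apply, mul_smul_comm, ← smul_sum, smul_sub] } with hL
  have hcomm : ∀ a b, a ∈ L → b - a ∈ commSpan K → b ∈ L := by
    rintro a b ⟨g, hg, ha⟩ hab
    exact ⟨g, hg, by have := add_mem hab ha; rwa [sub_add_sub_cancel] at this⟩
  have hJ : ∀ v ∈ jacobianIdeal G, ∀ e ∈ filt s, v * e ∈ L := by
    intro v hv
    induction hv using TwoSidedIdeal.span_induction with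
    | mem v hv =>
      intro e he
      obtain ⟨i, rfl⟩ : ∃ i, v = cyclicDeriv i G := by
        rcases hv with rfl | rfl
        exacts [⟨0, rfl⟩, ⟨1, rfl⟩]
      refine ⟨Pi.single i e, fun j => ?_, ?_⟩
      · by_cases hj : j = i
        · subst hj; simpa using he
        · rw [Pi.single_eq_of_ne hj]; exact zero_mem _
      · rw [sum_eq_single i (fun j _ hj => by rw [Pi.single_eq_of_ne hj, mul_zero]) (by simp),
          Pi.single_eq_same, sub_self]
        exact zero_mem _
    | zero => intro e _; rw [zero_mul]; exact zero_mem _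
    | add v w _ _ hv hw => intro e he; rw [add_mul]; exact add_mem (hv e he) (hw e he)
    | neg v _ hv => intro e he; rw [neg_mul]; exact neg_mem (hv e he)
    | left_absorb a v _ hv =>
      intro e he
      refine hcomm _ _ (hv (e * a) (mul_mem_filt_left he a)) ?_
      have := comm_mem_commSpan a (v * e)
      simpa only [mul_assoc] using this
    | right_absorb b v _ hv =>
      intro e he
      rw [mul_assoc]
      exact hv _ (mul_mem_filt_right b he)
  obtain ⟨ι, _, t, ht, hgen⟩ := exists_generators_filt K N
  obtain ⟨c, hc, rfl⟩ := hgen s h hh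
  have : ∑ i, t i * c i ∈ L := sum_mem fun i _ => hJ _ (hN _ (ht i)) _ (hc i)
  exact this

/-- A Newton step: writing the error cyclically as `∑ ∂_j(φ G) * g j` and substituting `letter z - g
z` cancels it. The quadratic remainder has order `2s + 1`, at least `N + s + 1` because `N ≤ s`. -/
theorem exists_isTangent_improve {G T : NCSeries K} (hG : G ∈ filt 3) {N s : ℕ}
    (hN : ∀ f ∈ filt N, f ∈ jacobianIdeal G) (hs : N ≤ s) (hs2 : 2 ≤ s)
    {φ : NCSeries K →ₐ[K] NCSeries K} (hφ : IsTangent φ) (h : φ G - T ∈ commFilt K (N + s)) :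
    ∃ ψ : NCSeries K →ₐ[K] NCSeries K, IsTangent ψ ∧ ψ G - T ∈ commFilt K (N + s + 1) ∧
      ∀ z, ψ (letter z) - φ (letter z) ∈ filt s := by
  obtain ⟨e, he, hce⟩ := exists_of_mem_commFilt h
  obtain ⟨g, hg, hge⟩ := exists_cyclic_decomposition (G := φ G)
    (filt_le_jacobianIdeal_algEquiv hN hφ.equiv) he
  have h1 := letter_sub_mem_filt (one_le_two.trans hs2) hg
  have hψ := isTangent_subst (fun z => filt_mono hs2 (hg z)) h1
  refine ⟨(subst _ h1).comp φ, hψ.comp hφ, ?_, fun z => ?_⟩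
  · have h2 := taylor_mem_commFilt (one_le_two.trans hs2) hg h1 (algHom_mem_filt φ hG)
    have h3 := add_mem (commFilt_mono (by omega : N + s + 1 ≤ 2 * s + 1) h2)
      (commSpan_le_commFilt _ (add_mem hge hce))
    convert h3 using 1
    rw [AlgHom.comp_apply]
    abel
  · have h2 := algHom_sub_self_mem_filt (φ := subst _ h1) (s := s)
      (fun z => by rw [subst_letter, sub_sub_cancel_left]; exact neg_mem (hg z))
      (algHom_letter_mem_filt φ z)
    simpa using h2

/-- A potential with finite-dimensional algebra is determined up to tangent changes of variables
by its terms of low degree. -/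
theorem exists_isTangent_of_sub_mem_commFilt [CharZero K] {G T : NCSeries K} (hG : G ∈ filt 3)
    {N : ℕ} (hN : ∀ f ∈ filt N, f ∈ jacobianIdeal G) (h : G - T ∈ commFilt K (N + (N + 2))) :
    ∃ φ : NCSeries K →ₐ[K] NCSeries K, IsTangent φ ∧ φ G - T ∈ commSpan K := by
  have step : ∀ (n : ℕ) (φ : {φ : NCSeries K →ₐ[K] NCSeries K //
      IsTangent φ ∧ φ G - T ∈ commFilt K (N + (N + 2 + n))}),
      ∃ ψ : {φ : NCSeries K →ₐ[K] NCSeries K //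
        IsTangent φ ∧ φ G - T ∈ commFilt K (N + (N + 2 + (n + 1)))},
      ∀ z, ψ.1 (letter z) - φ.1 (letter z) ∈ filt (N + 2 + n) := by
    rintro n ⟨φ, hφ, hφG⟩
    obtain ⟨ψ, hψ, hψG, hψφ⟩ := exists_isTangent_improve hG hN (by omega) (by omega) hφ hφG
    exact ⟨⟨ψ, hψ, hψG⟩, hψφ⟩
  choose next hnext using step
  have hid : IsTangent (AlgHom.id K (NCSeries K)) := fun z => by
    rw [AlgHom.id_apply, sub_self]; exact zero_mem _
  set u : ∀ n : ℕ, {φ : NCSeries K →ₐ[K] NCSeries K //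
      IsTangent φ ∧ φ G - T ∈ commFilt K (N + (N + 2 + n))} :=
    fun n => Nat.rec ⟨AlgHom.id K _, hid, h⟩ (fun n φ => next n φ) n with hu
  have hsucc : ∀ n, u (n + 1) = next n (u n) := fun n => rfl
  choose a ha using fun z => exists_limit (fun n => (u n).1 (letter z)) fun n => by
    rw [hsucc]
    exact filt_mono (by omega) (hnext n (u n) z)
  have ha2 : ∀ z, a z - letter z ∈ filt 2 := fun z => by
    have := add_mem (ha z 2) ((u 2).2.1 z)
    rwa [sub_add_sub_cancel] at this
  have ha1 : ∀ z, a z ∈ filt 1 := fun z => by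
    have := add_mem (filt_mono one_le_two (ha2 z)) (letter_mem_filt z)
    rwa [sub_add_cancel] at this
  refine ⟨subst a ha1, fun z => by rw [subst_letter]; exact ha2 z,
    mem_commSpan_of_forall_mem_commFilt fun n => ?_⟩
  have h1 : subst a ha1 G - (u n).1 G ∈ filt n :=
    filt_mono (Nat.le_add_right _ _) (algHom_sub_mem_filt (fun z => by
      rw [subst_letter]; exact ha z n) hG)
  have h2 := add_mem (filt_le_commFilt n h1)
    (commFilt_mono (by omega : n ≤ N + (N + 2 + n)) (u n).2.2)
  rwa [sub_add_sub_cancel] at h2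

end

/-! ### Reduction of the potential to normal form. -/

section

open Finset

variable {K : Type*} [Field K]

theorem cycDer_x (j : Fin 2) (P : NCSeries K) : cycDer j x P = if j = 0 then P else 0 :=
  cycDer_letter j 0 P

theorem cycDer_y (j : Fin 2) (P : NCSeries K) : cycDer j y P = if j = 1 then P else 0 :=
  cycDer_letter j 1 P

theorem cyclicDeriv_xxyCyc_zero :
    cyclicDeriv 0 (xxyCyc : NCSeries K) = (3 : K) • (x * y + y * x) := by
  rw [← cycDer_one_right, xxyCyc, cycDer_add_left, cycDer_add_left]
  simp only [cycDer_mul, cycDer_x, cycDer_y]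
  simp
  module

theorem cyclicDeriv_xxyCyc_one : cyclicDeriv 1 (xxyCyc : NCSeries K) = (3 : K) • (x * x) := by
  rw [← cycDer_one_right, xxyCyc, cycDer_add_left, cycDer_add_left]
  simp only [cycDer_mul, cycDer_x, cycDer_y]
  simp
  module

theorem cycDer_y_pow (m l : ℕ) :
    cycDer 1 (y ^ (m + 1)) (y ^ l : NCSeries K) = ((m + 1 : ℕ) : K) • y ^ (m + l) := by
  induction m generalizing l with
  | zero => simp [cycDer_y]
  | succ m ih =>
    rw [pow_succ, cycDer_mul, ← pow_succ', ih, cycDer_y, if_pos rfl, ← pow_add, ← add_assoc,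
      add_right_comm m l 1, add_comm l, add_right_comm m 1 l]
    push_cast
    module

theorem cyclicDeriv_y_pow_zero (m : ℕ) : cyclicDeriv 0 (y ^ m : NCSeries K) = 0 := by
  rw [← cycDer_one_right]
  suffices H : ∀ P : NCSeries K, cycDer 0 (y ^ m) P = 0 from H 1
  induction m with
  | zero => intro P; rw [pow_zero, cycDer_one_left]
  | succ m ih => intro P; rw [pow_succ, cycDer_mul, ih, cycDer_y]; simp

theorem cyclicDeriv_aeval_zero (p : Polynomial K) :
    cyclicDeriv 0 (Polynomial.aeval (y : NCSeries K) p) = 0 := by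
  rw [← cyclicDerivₗ_apply]
  induction p using Polynomial.induction_on' with
  | add p q hp hq => rw [map_add, map_add, hp, hq, add_zero]
  | monomial n a =>
    rw [Polynomial.aeval_monomial, ← Algebra.smul_def, map_smul, cyclicDerivₗ_apply,
      cyclicDeriv_y_pow_zero, smul_zero]

theorem cyclicDeriv_aeval_one (p : Polynomial K) :
    cyclicDeriv 1 (Polynomial.aeval (y : NCSeries K) p) =
      Polynomial.aeval y (Polynomial.derivative p) := by
  rw [← cyclicDerivₗ_apply]
  induction p using Polynomial.induction_on' with
  | add p q hp hq => simp only [map_add, hp, hq]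
  | monomial n a =>
    rw [Polynomial.aeval_monomial, ← Algebra.smul_def, map_smul, cyclicDerivₗ_apply,
      Polynomial.derivative_monomial, Polynomial.aeval_monomial, ← Algebra.smul_def,
      ← cycDer_one_right]
    cases n with
    | zero => simp [cycDer_one_left]
    | succ n =>
      have := cycDer_y_pow (K := K) n 0
      rw [pow_zero, add_zero] at this
      rw [this, smul_smul, Nat.add_sub_cancel]

theorem normalForm_eq (p : Polynomial K) :
    normalForm p = xxyCyc + Polynomial.aeval y (Polynomial.X ^ 4 * p) := by
  rw [normalForm, map_mul, map_pow, Polynomial.aeval_X]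

theorem cyclicDeriv_normalForm_zero (p : Polynomial K) :
    cyclicDeriv 0 (normalForm p) = (3 : K) • (x * y + y * x) := by
  rw [normalForm_eq, ← cycDer_one_right, cycDer_add_left, cycDer_one_right, cycDer_one_right,
    cyclicDeriv_xxyCyc_zero, cyclicDeriv_aeval_zero, add_zero]

theorem cyclicDeriv_normalForm_one (p : Polynomial K) :
    cyclicDeriv 1 (normalForm p) = (3 : K) • (x * x) +
      Polynomial.aeval y (Polynomial.derivative (Polynomial.X ^ 4 * p)) := by
  rw [normalForm_eq, ← cycDer_one_right, cycDer_add_left, cycDer_one_right, cycDer_one_right,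
    cyclicDeriv_xxyCyc_one, cyclicDeriv_aeval_one]

theorem normalForm_add_monomial (p : Polynomial K) (n : ℕ) (c : K) :
    normalForm (p + Polynomial.monomial n c) = normalForm p + c • y ^ (n + 4) := by
  rw [normalForm, normalForm, map_add, Polynomial.aeval_monomial, ← Algebra.smul_def, mul_add,
    mul_smul_comm, ← pow_add, add_comm 4, add_assoc]

theorem x_mem_filt : (x : NCSeries K) ∈ filt 1 := letter_mem_filt 0

theorem y_mem_filt : (y : NCSeries K) ∈ filt 1 := letter_mem_filt 1

theorem y_pow_mem_filt (n : ℕ) : (y ^ n : NCSeries K) ∈ filt n := by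
  induction n with
  | zero => exact filt_zero _
  | succ n ih => rw [pow_succ]; exact mul_mem_filt ih y_mem_filt

theorem xxyCyc_mem_filt : (xxyCyc : NCSeries K) ∈ filt 3 :=
  add_mem (add_mem (mul_mem_filt (mul_mem_filt x_mem_filt x_mem_filt) y_mem_filt)
    (mul_mem_filt (mul_mem_filt x_mem_filt y_mem_filt) x_mem_filt))
    (mul_mem_filt (mul_mem_filt y_mem_filt x_mem_filt) x_mem_filt)

variable (K) in
/-- The series which, up to commutators and terms of degree greater than `d`, are changes of
`xxyCyc` of first order in a change of variables of order `d - 2`. -/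
def tangentSpace (d : ℕ) : Submodule K (NCSeries K) where
  carrier := {h | ∃ g : Fin 2 → NCSeries K, (∀ j, g j ∈ filt (d - 2)) ∧
    h - ∑ j, cyclicDeriv j xxyCyc * g j ∈ commFilt K (d + 1)}
  add_mem' := by
    rintro a b ⟨g, hg, ha⟩ ⟨g', hg', hb⟩
    refine ⟨g + g', fun j => add_mem (hg j) (hg' j), ?_⟩
    convert add_mem ha hb using 1
    simp only [Pi.add_apply, mul_add, sum_add_distrib]
    abel
  zero_mem' := ⟨0, fun j => zero_mem _, by simp⟩
  smul_mem' := by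
    rintro c a ⟨g, hg, ha⟩
    refine ⟨c • g, fun j => Submodule.smul_mem _ _ (hg j), ?_⟩
    convert Submodule.smul_mem _ c ha using 1
    simp only [Pi.smul_apply, mul_smul_comm, ← smul_sum, smul_sub]

theorem mem_tangentSpace_of_sub_mem {d : ℕ} {a b : NCSeries K} (ha : a ∈ tangentSpace K d)
    (hab : b - a ∈ commFilt K (d + 1)) : b ∈ tangentSpace K d := by
  obtain ⟨g, hg, ha⟩ := ha
  exact ⟨g, hg, by have := add_mem hab ha; rwa [sub_add_sub_cancel] at this⟩

theorem commFilt_le_tangentSpace (d : ℕ) : commFilt K (d + 1) ≤ tangentSpace K d := fun a ha =>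
  mem_tangentSpace_of_sub_mem (zero_mem _) (by rwa [sub_zero])

theorem mul_cyclicDeriv_mul_mem_tangentSpace {d : ℕ} (j : Fin 2) {a b : NCSeries K}
    (hab : b * a ∈ filt (d - 2)) : a * cyclicDeriv j xxyCyc * b ∈ tangentSpace K d := by
  refine mem_tangentSpace_of_sub_mem (a := cyclicDeriv j xxyCyc * (b * a)) ?_ ?_
  · refine ⟨Pi.single j (b * a), fun i => ?_, ?_⟩
    · by_cases hi : i = j
      · subst hi; simpa using hab
      · rw [Pi.single_eq_of_ne hi]; exact zero_mem _
    · rw [sum_eq_single j (fun i _ hi => by rw [Pi.single_eq_of_ne hi, mul_zero]) (by simp),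
        Pi.single_eq_same, sub_self]
      exact zero_mem _
  · have := comm_mem_commFilt (d + 1) a (cyclicDeriv j xxyCyc * b)
    simpa only [mul_assoc] using this

theorem eq_shift_xy (f : NCSeries K) : f = f [] • 1 + (x * shift 0 f + y * shift 1 f) := by
  conv_lhs => rw [eq_shift f, Fin.sum_univ_two]
  rfl

theorem sub_coeff_nil_mem_filt (f : NCSeries K) : f - f [] • 1 ∈ filt 1 := by
  rw [mem_filt_one, coeff_sub, coeff_smul, coeff_one, if_pos rfl, mul_one, sub_self]

variable [CharZero K]

theorem mul_anticomm_mul_mem_tangentSpace {d : ℕ} {a b : NCSeries K}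
    (hab : b * a ∈ filt (d - 2)) : a * (x * y + y * x) * b ∈ tangentSpace K d := by
  have := Submodule.smul_mem _ (3 : K)⁻¹ (mul_cyclicDeriv_mul_mem_tangentSpace 0 hab)
  rwa [cyclicDeriv_xxyCyc_zero, mul_smul_comm, smul_mul_assoc,
    inv_smul_smul₀ (three_ne_zero)] at this

theorem mul_sq_mul_mem_tangentSpace {d : ℕ} {a b : NCSeries K}
    (hab : b * a ∈ filt (d - 2)) : a * (x * x) * b ∈ tangentSpace K d := by
  have := Submodule.smul_mem _ (3 : K)⁻¹ (mul_cyclicDeriv_mul_mem_tangentSpace 1 hab)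
  rwa [cyclicDeriv_xxyCyc_one, mul_smul_comm, smul_mul_assoc,
    inv_smul_smul₀ (three_ne_zero)] at this

/-- The relation `xy ≡ -yx` moves the letters `y` between the two `x` to the left, until `x²`
appears. -/
theorem mul_x_y_pow_x_mul_mem_tangentSpace {i j l d : ℕ} (hd : d = i + l + j + 2)
    {a b : NCSeries K} (ha : a ∈ filt i) (hb : b ∈ filt j) :
    a * x * y ^ l * x * b ∈ tangentSpace K d := by
  induction l generalizing i a with
  | zero =>
    rw [pow_zero, mul_one, mul_assoc a]
    exact mul_sq_mul_mem_tangentSpace (filt_mono (by omega) (mul_mem_filt hb ha))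
  | succ l ih =>
    have h1 := ih (i := i + 1) (by omega) (mul_mem_filt ha y_mem_filt)
    have h2 : a * (x * y + y * x) * (y ^ l * x * b) ∈ tangentSpace K d :=
      mul_anticomm_mul_mem_tangentSpace (filt_mono (by omega)
        (mul_mem_filt (mul_mem_filt (mul_mem_filt (y_pow_mem_filt l) x_mem_filt) hb) ha))
    convert sub_mem h2 h1 using 1
    rw [pow_succ']
    noncomm_ring

/-- Rotation identifies `y x y^l` with `x y^(l+1)`, so `(xy + yx) y^l` is cyclically twice `x
y^(l+1)`. -/
theorem x_y_pow_mem_tangentSpace (l : ℕ) :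
    (x * y ^ (l + 1) : NCSeries K) ∈ tangentSpace K (l + 2) := by
  have h1 : 1 * (x * y + y * x) * y ^ l ∈ tangentSpace K (l + 2) :=
    mul_anticomm_mul_mem_tangentSpace (filt_mono (by omega)
      (mul_mem_filt (y_pow_mem_filt l) (filt_zero 1)))
  have h2 := commFilt_le_tangentSpace _ (comm_mem_commFilt (l + 2 + 1) (x * y ^ l : NCSeries K) y)
  have h3 := Submodule.smul_mem _ (2 : K)⁻¹ (add_mem h1 h2)
  convert h3 using 1
  rw [eq_inv_smul_iff₀ two_ne_zero, two_smul, pow_succ']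
  have : (y : NCSeries K) ^ l * y = y * y ^ l := by rw [← pow_succ, pow_succ']
  simp only [mul_assoc, this, one_mul, add_mul]
  abel

theorem x_y_pow_mul_mem_tangentSpace {m l d : ℕ} (hd : d = 1 + l + m) (h2 : 2 ≤ d)
    {f : NCSeries K} (hf : f ∈ filt m) : x * y ^ l * f ∈ tangentSpace K d := by
  induction m generalizing l f with
  | zero =>
    obtain ⟨l, rfl⟩ := Nat.exists_eq_add_of_le' (by omega : 1 ≤ l)
    obtain rfl : d = l + 2 := by omega
    refine mem_tangentSpace_of_sub_mem
      (Submodule.smul_mem _ (f []) (x_y_pow_mem_tangentSpace l)) (filt_le_commFilt _ ?_)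
    have := mul_mem_filt (mul_mem_filt x_mem_filt (y_pow_mem_filt (l + 1)))
      (sub_coeff_nil_mem_filt f)
    rw [mul_sub, mul_smul_comm, mul_one] at this
    exact filt_mono (by omega) this
  | succ m ih =>
    have h1 := ih (l := l + 1) (by omega) ((filt_succ.1 hf).2 1)
    have h2 : 1 * x * y ^ l * x * shift 0 f ∈ tangentSpace K d :=
      mul_x_y_pow_x_mul_mem_tangentSpace (by omega) (filt_zero 1) ((filt_succ.1 hf).2 0)
    rw [eq_shift_xy f, (filt_succ.1 hf).1, zero_smul, zero_add]
    convert add_mem h2 h1 using 1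
    rw [pow_succ]
    noncomm_ring

/-- Reading `f` letter by letter, a `y` lengthens the initial power, and at the first `x` a rotation
brings that `x` to the front, where the preceding lemma applies. Only `y^d` survives. -/
theorem exists_y_pow_mul_sub_mem_tangentSpace {m l d : ℕ} (hd : d = l + m) (h2 : 2 ≤ d)
    {f : NCSeries K} (hf : f ∈ filt m) : ∃ c : K, y ^ l * f - c • y ^ d ∈ tangentSpace K d := by
  induction m generalizing l f with
  | zero =>
    obtain rfl : d = l := by omega
    refine ⟨f [], commFilt_le_tangentSpace _ (filt_le_commFilt _ ?_)⟩
    have := mul_mem_filt (y_pow_mem_filt d) (sub_coeff_nil_mem_filt f)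
    rwa [mul_sub, mul_smul_comm, mul_one] at this
  | succ m ih =>
    obtain ⟨c, hc⟩ := ih (l := l + 1) (by omega) ((filt_succ.1 hf).2 1)
    have h3 : x * y ^ 0 * (shift 0 f * y ^ l) ∈ tangentSpace K d :=
      x_y_pow_mul_mem_tangentSpace (m := m + l) (by omega) h2
        (mul_mem_filt ((filt_succ.1 hf).2 0) (y_pow_mem_filt l))
    have h4 := commFilt_le_tangentSpace d (comm_mem_commFilt (d + 1) (y ^ l) (x * shift 0 f))
    refine ⟨c, ?_⟩
    rw [eq_shift_xy f, (filt_succ.1 hf).1, zero_smul, zero_add]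
    convert add_mem (add_mem h3 h4) hc using 1
    rw [pow_succ]
    noncomm_ring

theorem exists_isTangent_sub_normalForm_mem {F : NCSeries K} (hF : F - xxyCyc ∈ filt 4) (d : ℕ) :
    ∃ φ : NCSeries K →ₐ[K] NCSeries K, IsTangent φ ∧
      ∃ p : Polynomial K, φ F - normalForm p ∈ commFilt K (d + 4) := by
  induction d with
  | zero =>
    refine ⟨AlgHom.id K _, fun z => ?_, 0, filt_le_commFilt _ ?_⟩
    · rw [AlgHom.id_apply, sub_self]; exact zero_mem _
    · simpa [normalForm] using hF
  | succ d ih =>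
    obtain ⟨φ, hφ, p, hp⟩ := ih
    obtain ⟨e, he, hce⟩ := exists_of_mem_commFilt hp
    obtain ⟨c, g, hg, hge⟩ := exists_y_pow_mul_sub_mem_tangentSpace (l := 0) (zero_add _).symm
      (by omega) he
    rw [pow_zero, one_mul] at hge
    rw [show d + 4 - 2 = d + 2 by omega] at hg
    have hF3 : F ∈ filt 3 := by
      have := add_mem (filt_mono (by omega : 3 ≤ 4) hF) xxyCyc_mem_filt
      rwa [sub_add_cancel] at this
    have hφF : φ F - xxyCyc ∈ filt 4 := by
      have := add_mem (algHom_sub_self_mem_filt hφ hF3) hF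
      rwa [sub_add_sub_cancel] at this
    have h1 := letter_sub_mem_filt (by omega : 1 ≤ d + 2) hg
    refine ⟨(subst _ h1).comp φ,
      (isTangent_subst (fun z => filt_mono (by omega) (hg z)) h1).comp hφ,
      p + Polynomial.monomial d c, ?_⟩
    have h2 := taylor_mem_commFilt (by omega) hg h1 (algHom_mem_filt φ hF3)
    -- Only the leading part of `φ F` matters to first order: the derivatives of the rest have order
    -- 3 and `g` has order `d + 2`.
    have h3 : ∑ j, (cyclicDeriv j (φ F) - cyclicDeriv j xxyCyc) * g j ∈ filt (d + 5) := by
      refine sum_mem fun j _ => ?_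
      rw [← cyclicDerivₗ_apply, ← cyclicDerivₗ_apply, ← map_sub, cyclicDerivₗ_apply]
      exact filt_mono (by omega) (mul_mem_filt (cyclicDeriv_mem_filt j hφF) (hg j))
    have h4 := add_mem (sub_mem (add_mem (commFilt_mono (by omega : d + 5 ≤ 2 * (d + 2) + 1) h2) hge)
      (filt_le_commFilt _ h3)) (commSpan_le_commFilt _ hce)
    rw [show d + 1 + 4 = d + 5 by omega]
    convert h4 using 1
    rw [AlgHom.comp_apply, normalForm_add_monomial]
    simp only [sub_mul, sum_sub_distrib]
    abel

theorem exists_elementary_normalForm {F : NCSeries K} (hF : F - xxyCyc ∈ filt 4)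
    [Module.Finite K (PotentialAlgebra F)] :
    ∃ φ ∈ Submonoid.closure {ψ : NCSeries K ≃ₐ[K] NCSeries K | IsElementaryChange ψ},
      ∃ p : Polynomial K, CycEquiv (φ F) (normalForm p) := by
  obtain ⟨N, hN⟩ := exists_filt_le_of_finite (jacobianIdeal F)
  obtain ⟨φ, hφ, p, hp⟩ := exists_isTangent_sub_normalForm_mem hF (N + (N + 2))
  have hφF : φ F ∈ filt 3 := by
    have := add_mem (filt_mono (by omega : 3 ≤ 4) hF) xxyCyc_mem_filt
    rw [sub_add_cancel] at this
    exact algHom_mem_filt φ this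
  obtain ⟨ψ, hψ, h⟩ := exists_isTangent_of_sub_mem_commFilt hφF
    (filt_le_jacobianIdeal_algEquiv hN hφ.equiv) (commFilt_mono (by omega) hp)
  exact ⟨(hψ.comp hφ).equiv, (hψ.comp hφ).equiv_mem_closure, p, h⟩

end

/-! ### Linear independence of the monomials via an explicit module. -/

section

open Finset

variable {K : Type*} [Field K]

section Evaluation

variable {V : Type*} [AddCommGroup V] [Module K V] {T : Fin 2 → V →ₗ[K] V} {e : V}
  {S : ℕ → Submodule K V} {U : Submodule K V} {n : ℕ}

/-- Truncation spoils compatibility with the action only by elements of `S n`. Modulo a stable `U`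
containing `S n`, the truncated evaluation is a genuine module map. -/
theorem evalTrunc_letter_mul_sub_mem (h0 : S 0 = ⊤)
    (hS : ∀ n z v, v ∈ S n → T z v ∈ S (n + 1)) (hSU : S n ≤ U) (hU : ∀ z, ∀ v ∈ U, T z v ∈ U)
    (z : Fin 2) {f : NCSeries K} {v : V} (hf : evalTrunc T e n f - v ∈ U) :
    evalTrunc T e n (letter z * f) - T z v ∈ U := by
  have h1 := hSU (evalTrunc_succ_sub_mem T e S h0 hS n (letter z * f))
  have h2 : evalTrunc T e (n + 1) (letter z * f) = T z (evalTrunc T e n f) := by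
    rw [evalTrunc_succ, coeff_mul_nil, letter_nil, zero_mul, zero_smul, zero_add,
      sum_eq_single z (fun b _ hb => by rw [shift_letter_mul, if_neg hb, map_zero, map_zero])
        (by simp), shift_letter_mul, if_pos rfl]
  have h3 := hU z _ hf
  rw [map_sub] at h3
  rw [h2] at h1
  have := sub_mem h3 h1
  rwa [sub_sub_sub_cancel_left] at this

theorem evalTrunc_one_sub_mem (h0 : S 0 = ⊤)
    (hS : ∀ n z v, v ∈ S n → T z v ∈ S (n + 1)) (hSU : S n ≤ U) :
    evalTrunc T e n 1 - e ∈ U := by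
  have h1 := hSU (evalTrunc_succ_sub_mem T e S h0 hS n 1)
  rw [evalTrunc_succ] at h1
  simp only [shift_one, map_zero, sum_const_zero, add_zero, coeff_one, if_true, one_smul] at h1
  rw [← neg_sub]
  exact neg_mem h1

theorem evalTrunc_mul_mul_mem (h0 : S 0 = ⊤)
    (hS : ∀ n z v, v ∈ S n → T z v ∈ S (n + 1)) (hSU : S n ≤ U) (hU : ∀ z, ∀ v ∈ U, T z v ∈ U)
    {P : NCSeries K} (hP : ∀ H, evalTrunc T e n (P * H) ∈ U) (G H : NCSeries K) :
    evalTrunc T e n (G * P * H) ∈ U := by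
  suffices h : ∀ i G, evalTrunc T e n (G * P * H) ∈ U ⊔ S i by
    have := h n G
    rwa [sup_eq_left.2 hSU] at this
  intro i
  induction i with
  | zero => intro G; rw [h0, sup_top_eq]; trivial
  | succ i ih =>
    intro G
    have : G * P * H = G [] • (P * H) + ∑ z, letter z * (shift z G * P * H) := by
      conv_lhs => rw [eq_shift G]
      simp only [add_mul, sum_mul, smul_mul_assoc, one_mul, mul_assoc]
    rw [this, map_add, map_smul, map_sum]
    refine add_mem (Submodule.smul_mem _ _ (Submodule.mem_sup_left (hP H)))
      (sum_mem fun z _ => ?_)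
    have h1 := evalTrunc_letter_mul_sub_mem (e := e) h0 hS hSU hU z
      (f := shift z G * P * H) (v := evalTrunc T e n (shift z G * P * H)) (by
        rw [sub_self]; exact zero_mem _)
    obtain ⟨u, hu, s, hs, hus⟩ := Submodule.mem_sup.1 (ih (shift z G))
    rw [← sub_add_cancel (evalTrunc T e n (letter z * (shift z G * P * H)))
      (T z (evalTrunc T e n (shift z G * P * H)))]
    refine add_mem (Submodule.mem_sup_left h1) ?_
    rw [← hus, map_add]
    exact add_mem (Submodule.mem_sup_left (hU z u hu)) (Submodule.mem_sup_right (hS i z s hs))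

theorem evalTrunc_mem_of_mem_jacobianIdeal (h0 : S 0 = ⊤)
    (hS : ∀ n z v, v ∈ S n → T z v ∈ S (n + 1)) (hSU : S n ≤ U) (hU : ∀ z, ∀ v ∈ U, T z v ∈ U)
    {F : NCSeries K} (hF : ∀ j H, evalTrunc T e n (cyclicDeriv j F * H) ∈ U)
    {f : NCSeries K} (hf : f ∈ jacobianIdeal F) : evalTrunc T e n f ∈ U := by
  suffices h : ∀ H, evalTrunc T e n (f * H) ∈ U by simpa using h 1
  induction hf using TwoSidedIdeal.span_induction with
  | mem v hv =>
    rcases hv with rfl | rfl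
    exacts [hF 0, hF 1]
  | zero => intro H; rw [zero_mul, map_zero]; exact zero_mem _
  | add v w _ _ hv hw => intro H; rw [add_mul, map_add]; exact add_mem (hv H) (hw H)
  | neg v _ hv => intro H; rw [neg_mul, map_neg]; exact neg_mem (hv H)
  | left_absorb a v _ hv => exact fun H => evalTrunc_mul_mul_mem h0 hS hSU hU hv a H
  | right_absorb b v _ hv => intro H; rw [mul_assoc]; exact hv _

end Evaluation

section Model

open Polynomial

/-- The action of the letters on `K[t] ⊕ x K[t]`, where `y` anticommutes with `x` and
`x² = r`. -/
def modelAction (r : K[X]) : Fin 2 → K[X] × K[X] →ₗ[K] K[X] × K[X] :=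
  ![(LinearMap.mulLeft K r ∘ₗ LinearMap.snd K _ _).prod (LinearMap.fst K _ _),
    (LinearMap.mulLeft K X).prodMap (-LinearMap.mulLeft K X)]

variable (K) in
/-- The pairs of polynomials divisible by `t ^ a` and `t ^ b`. -/
def modelSub (a b : ℕ) : Submodule K (K[X] × K[X]) where
  carrier := {v | X ^ a ∣ v.1 ∧ X ^ b ∣ v.2}
  add_mem' hv hw := ⟨dvd_add hv.1 hw.1, dvd_add hv.2 hw.2⟩
  zero_mem' := ⟨dvd_zero _, dvd_zero _⟩
  smul_mem' c v hv := ⟨by rw [Prod.smul_fst, smul_eq_C_mul]; exact hv.1.mul_left _,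
    by rw [Prod.smul_snd, smul_eq_C_mul]; exact hv.2.mul_left _⟩

/-- The letter `x` moves the first component to the second without raising its `t`-order, and only
the return multiplies by `r`. Hence the bounds grow alternately, once in two letters each. -/
theorem modelAction_mem_filtration {r : K[X]} (hr : X ∣ r) (n : ℕ) (z : Fin 2) (v : K[X] × K[X])
    (hv : v ∈ modelSub K ((n + 1) / 2) (n / 2)) :
    modelAction r z v ∈ modelSub K ((n + 1 + 1) / 2) ((n + 1) / 2) := by
  have h1 : (n + 1 + 1) / 2 = n / 2 + 1 := by omega
  have h2 : n / 2 + 1 ≤ (n + 1) / 2 + 1 := by omega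
  have h3 : (n + 1) / 2 ≤ n / 2 + 1 := by omega
  obtain ⟨hv1, hv2⟩ := hv
  fin_cases z
  · refine ⟨?_, hv1⟩
    change _ ∣ r * v.2
    rw [h1, pow_succ']
    exact mul_dvd_mul hr hv2
  · refine ⟨?_, ?_⟩
    · change _ ∣ X * v.1
      rw [h1]
      refine (pow_dvd_pow _ h2).trans ?_
      rw [pow_succ']
      exact mul_dvd_mul_left _ hv1
    · change _ ∣ -(X * v.2)
      rw [dvd_neg]
      refine (pow_dvd_pow _ h3).trans ?_
      rw [pow_succ']
      exact mul_dvd_mul_left _ hv2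

theorem modelAction_mem_modelSub {r : K[X]} {a b : ℕ} (hab : b ≤ a) (hr : X ^ a ∣ X ^ b * r)
    (z : Fin 2) (v : K[X] × K[X]) (hv : v ∈ modelSub K a b) :
    modelAction r z v ∈ modelSub K a b := by
  obtain ⟨hv1, hv2⟩ := hv
  fin_cases z
  · refine ⟨?_, (pow_dvd_pow _ hab).trans hv1⟩
    change _ ∣ r * v.2
    rw [mul_comm]
    exact hr.trans (mul_dvd_mul_right hv2 r)
  · exact ⟨hv1.mul_left _, (dvd_neg.2 (hv2.mul_left _))⟩

/-- The divisibilities make the model modulo `(t^a, t^b)` a module over the potential algebra.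
Acting on `(1, 0)`, `y^m` gives `(t^m, 0)` and `x y^m` gives `(0, t^m)`, which are independent for
`m < a` and `m < b` respectively. -/
theorem linearIndependent_monomials_of_dvd [CharZero K] {p r : K[X]}
    (hr : derivative (X ^ 4 * p) = (-3 : K) • r) {a b : ℕ} (hX : X ∣ r) (hab : b ≤ a)
    (hra : X ^ a ∣ X ^ b * r) (hrb : X ^ b ∣ r - r.comp (-X)) :
    LinearIndependent K (Sum.elim (fun N : Fin a => toA (normalForm p) (y ^ (N : ℕ)))
      (fun N : Fin b => toA (normalForm p) (x * y ^ (N : ℕ)))) := by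
  set S : ℕ → Submodule K (K[X] × K[X]) := fun n => modelSub K ((n + 1) / 2) (n / 2) with hS
  set U := modelSub K a b with hU
  set e : K[X] × K[X] := (1, 0) with he
  -- Degree `2 * a` suffices: `S (2 * a)` is `modelSub K a a`, contained in `U` as `b ≤ a`.
  set ν := evalTrunc (modelAction r) e (2 * a) with hν
  have h0 : S 0 = ⊤ := by
    refine eq_top_iff.2 fun v _ => ⟨?_, ?_⟩ <;> simp
  have hSS : ∀ n z v, v ∈ S n → modelAction r z v ∈ S (n + 1) := modelAction_mem_filtration hX
  have hSU : S (2 * a) ≤ U := fun v hv =>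
    ⟨(pow_dvd_pow _ (by omega)).trans hv.1, (pow_dvd_pow _ (by omega)).trans hv.2⟩
  have hUU : ∀ z, ∀ v ∈ U, modelAction r z v ∈ U := modelAction_mem_modelSub hab hra
  have hx : ∀ f v, ν f - v ∈ U → ν (x * f) - (r * v.2, v.1) ∈ U := fun f v h =>
    evalTrunc_letter_mul_sub_mem h0 hSS hSU hUU 0 h
  have hy : ∀ f v, ν f - v ∈ U → ν (y * f) - (X * v.1, -(X * v.2)) ∈ U := fun f v h =>
    evalTrunc_letter_mul_sub_mem h0 hSS hSU hUU 1 h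
  have hypow : ∀ (m : ℕ) f v, ν f - v ∈ U → ν (y ^ m * f) - (X ^ m * v.1, (-X) ^ m * v.2) ∈ U := by
    intro m
    induction m with
    | zero => intro f v h; simpa using h
    | succ m ih =>
      intro f v h
      have := hy _ _ (ih f v h)
      rw [pow_succ', mul_assoc]
      convert this using 3 <;> ring
  have haeval : ∀ (q : K[X]) f v, ν f - v ∈ U →
      ν (aeval y q * f) - (q * v.1, q.comp (-X) * v.2) ∈ U := by
    intro q f v h
    induction q using Polynomial.induction_on' with
    | add q q' hq hq' =>
      convert add_mem hq hq' using 1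
      rw [map_add, add_mul, map_add, add_comp, add_mul, add_mul, ← Prod.mk_add_mk]
      abel
    | monomial m c =>
      convert U.smul_mem c (hypow m f v h) using 1
      rw [aeval_monomial, ← Algebra.smul_def, smul_mul_assoc, map_smul, smul_sub]
      congr 1
      ext1
      · rw [← C_mul_X_pow_eq_monomial, Prod.smul_fst, smul_eq_C_mul, mul_assoc]
      · rw [monomial_comp, Prod.smul_snd, smul_eq_C_mul, mul_assoc]
  have hν0 : ∀ f, ν f - ν f ∈ U := fun f => by rw [sub_self]; exact zero_mem _
  have hJ : ∀ j H, ν (cyclicDeriv j (normalForm p) * H) ∈ U := by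
    intro j H
    fin_cases j
    · change ν (cyclicDeriv 0 (normalForm p) * H) ∈ U
      rw [cyclicDeriv_normalForm_zero, smul_mul_assoc, map_smul]
      refine U.smul_mem _ ?_
      have h1 := add_mem (hx _ _ (hy _ _ (hν0 H))) (hy _ _ (hx _ _ (hν0 H)))
      rw [add_mul, map_add, mul_assoc, mul_assoc]
      convert h1 using 1
      rw [sub_add_sub_comm, eq_comm, sub_eq_self]
      ext1 <;> simp
      ring
    · change ν (cyclicDeriv 1 (normalForm p) * H) ∈ U
      rw [cyclicDeriv_normalForm_one, add_mul, smul_mul_assoc, map_add, map_smul, mul_assoc, hr]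
      have h1 := add_mem (U.smul_mem (3 : K) (hx _ _ (hx _ _ (hν0 H))))
        (haeval ((-3 : K) • r) _ _ (hν0 H))
      -- On the second component `x²` acts by `r(t)` but `r(y)` by `r(-t)`, since `y` acts there by
      -- `-t`. The defect is absorbed because `t^b` divides `r(t) - r(-t)`.
      have h2 : ((0 : K[X]), (3 : K) • ((r - r.comp (-X)) * (ν H).2)) ∈ U :=
        ⟨dvd_zero _, by rw [smul_eq_C_mul]; exact (hrb.mul_right _).mul_left _⟩
      convert add_mem h1 h2 using 1
      simp only [smul_sub, smul_comp]
      rw [add_assoc, ← sub_eq_zero]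
      ext1
      · simp
      · simp [sub_mul, smul_sub]
  have hone : ν 1 - e ∈ U := evalTrunc_one_sub_mem h0 hSS hSU
  have hmy : ∀ m : ℕ, ν (y ^ m) - (X ^ m, 0) ∈ U := fun m => by
    have := hypow m _ _ hone
    simpa [he] using this
  have hmx : ∀ m : ℕ, ν (x * y ^ m) - (0, X ^ m) ∈ U := fun m => by
    have := hx _ _ (hmy m)
    simpa using this
  rw [Fintype.linearIndependent_iff]
  intro g hg
  set f : NCSeries K := ∑ N : Fin a, g (Sum.inl N) • y ^ (N : ℕ) +
    ∑ N : Fin b, g (Sum.inr N) • (x * y ^ (N : ℕ)) with hf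
  have hfI : f ∈ jacobianIdeal (normalForm p) := by
    have h1 : ((jacobianIdeal (normalForm p)).ringCon.mkₐ (α := K)) f = 0 := by
      rw [← hg, Fintype.sum_sum_type, hf]
      simp only [map_add, map_sum, map_smul, Sum.elim_inl, Sum.elim_inr]
      rfl
    have h2 : ((f : (jacobianIdeal (normalForm p)).ringCon.Quotient)) =
      ((0 : NCSeries K) : (jacobianIdeal (normalForm p)).ringCon.Quotient) := h1
    rw [RingCon.eq, TwoSidedIdeal.rel_iff, sub_zero] at h2
    exact h2
  have hfU : ν f ∈ U := evalTrunc_mem_of_mem_jacobianIdeal h0 hSS hSU hUU hJ hfI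
  have hfv : ν f - (∑ N : Fin a, g (Sum.inl N) • X ^ (N : ℕ),
      ∑ N : Fin b, g (Sum.inr N) • X ^ (N : ℕ)) ∈ U := by
    have h1 : ∑ N : Fin a, g (Sum.inl N) • (ν (y ^ (N : ℕ)) - (X ^ (N : ℕ), 0)) +
        ∑ N : Fin b, g (Sum.inr N) • (ν (x * y ^ (N : ℕ)) - (0, X ^ (N : ℕ))) ∈ U :=
      add_mem (sum_mem fun N _ => U.smul_mem _ (hmy N)) (sum_mem fun N _ => U.smul_mem _ (hmx N))
    convert h1 using 1
    rw [hf, map_add, map_sum, map_sum]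
    simp only [map_smul, smul_sub, sum_sub_distrib, sub_add_sub_comm]
    congr 1
    ext1 <;> simp [Prod.fst_sum, Prod.snd_sum]
  have hvU := sub_mem hfU hfv
  rw [sub_sub_cancel] at hvU
  have hcoeff : ∀ (c : ℕ) (d : Fin c → K), X ^ c ∣ ∑ N : Fin c, d N • (X : K[X]) ^ (N : ℕ) →
      ∀ N, d N = 0 := by
    intro c d hd N
    rw [X_pow_dvd_iff] at hd
    have := hd N N.2
    rw [finsetSum_coeff] at this
    simp only [Polynomial.coeff_smul, coeff_X_pow, smul_eq_mul] at this
    rw [sum_eq_single N (fun M _ hM => by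
      rw [if_neg (fun h => hM (Fin.ext h.symm)), mul_zero]) (by simp)] at this
    simpa using this
  rintro (N | N)
  · exact hcoeff a _ hvU.1 N
  · exact hcoeff b _ hvU.2 N

end Model

end

/-! ### Spanning by the monomials, nonvanishing of the even part, and the exponents. -/

section

open Finset Polynomial

variable {K : Type*} [Field K]

theorem constCoeff_aeval_y (u : K[X]) : constCoeff (aeval (y : NCSeries K) u) = u.coeff 0 := by
  induction u using Polynomial.induction_on' with
  | add p q hp hq => simp only [map_add, hp, hq, Polynomial.coeff_add]
  | monomial n a =>
    rw [aeval_monomial, ← Algebra.smul_def, map_smul, constCoeff_apply, coeff_monomial]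
    cases n with
    | zero => simp [coeff_one]
    | succ n => simp [pow_succ, coeff_mul_nil, mem_filt_one.1 y_mem_filt]

theorem coeff_comp_neg_X (q : K[X]) (i : ℕ) : (q.comp (-X)).coeff i = (-1) ^ i * q.coeff i := by
  rw [← neg_one_mul, ← C_1, ← C_neg, comp_C_mul_X_coeff, mul_comm]

theorem coeff_evenPart (p : K[X]) (i : ℕ) :
    (evenPart p).coeff i = if Even i then p.coeff i else 0 := by
  rw [evenPart, finsetSum_coeff]
  simp only [coeff_monomial, sum_ite_eq', mem_filter, mem_support_iff]
  by_cases h : p.coeff i = 0 <;> simp [h]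

section Relations

variable {A : Type*} [Ring A] [Algebra K A] {a b : A}

theorem mul_aeval_of_anticomm (h : a * b = -(b * a)) (q : K[X]) :
    a * aeval b q = aeval b (q.comp (-X)) * a := by
  induction q using Polynomial.induction_on' with
  | add p q hp hq => rw [map_add, mul_add, hp, hq, add_comp, map_add, add_mul]
  | monomial n c =>
    have hn : a * b ^ n = (-b) ^ n * a := by
      have : SemiconjBy a b (-b) := by rw [SemiconjBy, h, neg_mul]
      exact (this.pow_right n)
    rw [aeval_monomial, monomial_comp, map_mul, map_pow, aeval_C, map_neg, aeval_X,
      ← Algebra.smul_def, mul_smul_comm, hn, ← Algebra.smul_def, smul_mul_assoc]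

theorem span_monomials_mul_mem (h : a * b = -(b * a)) {r : K[X]} (hr : a * a = aeval b r) {v : A}
    (hv : v ∈ Submodule.span K (Set.range (Sum.elim (fun N : ℕ => b ^ N) fun N : ℕ => a * b ^ N))) :
    a * v ∈ Submodule.span K (Set.range (Sum.elim (fun N : ℕ => b ^ N) fun N : ℕ => a * b ^ N)) ∧
    b * v ∈ Submodule.span K
      (Set.range (Sum.elim (fun N : ℕ => b ^ N) fun N : ℕ => a * b ^ N)) := by
  set S := Submodule.span K (Set.range (Sum.elim (fun N : ℕ => b ^ N) fun N : ℕ => a * b ^ N))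
    with hS
  have hb : ∀ N, b ^ N ∈ S := fun N => Submodule.subset_span ⟨Sum.inl N, rfl⟩
  have ha : ∀ N, a * b ^ N ∈ S := fun N => Submodule.subset_span ⟨Sum.inr N, rfl⟩
  suffices H : S ≤ S.comap (LinearMap.mulLeft K a) ⊓ S.comap (LinearMap.mulLeft K b) from H hv
  refine Submodule.span_le.2 ?_
  rintro _ ⟨N | N, rfl⟩
  · refine ⟨ha N, ?_⟩
    change b * b ^ N ∈ S
    rw [← pow_succ']
    exact hb _
  · refine ⟨?_, ?_⟩
    · change a * (a * b ^ N) ∈ S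
      rw [← mul_assoc, hr, aeval_eq_sum_range, sum_mul]
      refine sum_mem fun i _ => ?_
      rw [smul_mul_assoc, ← pow_add]
      exact S.smul_mem _ (hb _)
    · change b * (a * b ^ N) ∈ S
      rw [← mul_assoc, ← neg_eq_iff_eq_neg.2 h, neg_mul, mul_assoc, ← pow_succ']
      exact S.neg_mem (ha _)

end Relations

theorem toA_eq_zero_iff {F f : NCSeries K} : toA F f = 0 ↔ f ∈ jacobianIdeal F := by
  rw [← sub_zero f, ← TwoSidedIdeal.rel_iff, ← RingCon.eq, sub_zero]
  rfl

/-- The quotient map onto a potential algebra. -/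
def toAₐ (F : NCSeries K) : NCSeries K →ₐ[K] PotentialAlgebra F :=
  (jacobianIdeal F).ringCon.mkₐ (α := K)

theorem toAₐ_apply (F f : NCSeries K) : toAₐ F f = toA F f := rfl

theorem toAₐ_surjective (F : NCSeries K) : Function.Surjective (toAₐ F) :=
  RingCon.mkₐ_surjective _

/-- Peeling off `N` letters leaves a remainder of order `N`, which vanishes in the quotient; so
finite words suffice. -/
theorem mem_of_stable {F : NCSeries K} {N : ℕ} (hN : ∀ f ∈ filt N, f ∈ jacobianIdeal F)
    {S : Submodule K (PotentialAlgebra F)} (h1 : 1 ∈ S)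
    (hS : ∀ v ∈ S, toA F x * v ∈ S ∧ toA F y * v ∈ S) : S = ⊤ := by
  have key : ∀ n f, ∃ g ∈ filt n, toAₐ F (f - g) ∈ S := by
    intro n
    induction n with
    | zero => exact fun f => ⟨f, filt_zero f, by rw [sub_self, map_zero]; exact zero_mem _⟩
    | succ n ih =>
      intro f
      choose g hg hgS using fun z => ih (shift z f)
      refine ⟨x * g 0 + y * g 1, add_mem ?_ ?_, ?_⟩
      · rw [add_comm]; exact mul_mem_filt x_mem_filt (hg 0)
      · rw [add_comm]; exact mul_mem_filt y_mem_filt (hg 1)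
      · have h2 : f - (x * g 0 + y * g 1) =
            f [] • 1 + (x * (shift 0 f - g 0) + y * (shift 1 f - g 1)) := by
          conv_lhs => rw [eq_shift_xy f]
          noncomm_ring
        rw [h2, map_add, map_add, map_smul, map_one, map_mul, map_mul]
        exact add_mem (S.smul_mem _ h1) (add_mem (hS _ (hgS 0)).1 (hS _ (hgS 1)).2)
  refine eq_top_iff.2 fun v _ => ?_
  obtain ⟨f, rfl⟩ := toAₐ_surjective F v
  obtain ⟨g, hg, hgS⟩ := key N f
  rwa [map_sub, toAₐ_apply F g, toA_eq_zero_iff.2 (hN g hg), sub_zero] at hgS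

variable [CharZero K]

/-- Comparing `x * x²` with `x² * x` gives `(r(y) - r(-y)) x = 0`. A series in `y` is a power of `y`
times a unit, so `y^b x = 0`; then `y^b r(y) = y^b x² = 0` gives `y^(b+c) = 0`. -/
theorem span_monomials_eq_top {p r : K[X]} (hr : derivative (X ^ 4 * p) = (-3 : K) • r) {b c N : ℕ}
    (hN : ∀ f ∈ filt N, f ∈ jacobianIdeal (normalForm p))
    (hc : X ^ c ∣ r) (hc0 : r.coeff c ≠ 0)
    (hb : X ^ b ∣ r - r.comp (-X)) (hb0 : (r - r.comp (-X)).coeff b ≠ 0) :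
    Submodule.span K (Set.range (Sum.elim
      (fun N : Fin (b + c) => toA (normalForm p) (y ^ (N : ℕ)))
      (fun N : Fin b => toA (normalForm p) (x * y ^ (N : ℕ))))) = ⊤ := by
  set π := toAₐ (normalForm p) with hπ
  have hzero : ∀ j, π (cyclicDeriv j (normalForm p)) = 0 := fun j =>
    toA_eq_zero_iff.2 (cyclicDeriv_mem_jacobianIdeal _ j)
  have hxy : π x * π y = -(π y * π x) := by
    have := hzero 0
    rw [cyclicDeriv_normalForm_zero, map_smul, smul_eq_zero, or_iff_right three_ne_zero, map_add,
      map_mul, map_mul] at this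
    exact eq_neg_of_add_eq_zero_left this
  have haeval : ∀ q : K[X], π (aeval y q) = aeval (π y) q := fun q => (aeval_algHom_apply π y q).symm
  have hxx : π x * π x = aeval (π y) r := by
    have := hzero 1
    rw [cyclicDeriv_normalForm_one, hr, map_smul, map_add, map_smul, map_smul, neg_smul,
      ← sub_eq_add_neg, ← smul_sub, smul_eq_zero, or_iff_right three_ne_zero, map_mul, haeval,
      sub_eq_zero] at this
    exact this
  have hunit : ∀ u : K[X], u.coeff 0 ≠ 0 → IsUnit (aeval (π y) u) := fun u hu => by
    rw [← haeval]
    rw [← constCoeff_aeval_y] at hu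
    exact (isUnit_of_coeff_nil_ne_zero hu).map π
  have hcancel : ∀ (q : K[X]) (m : ℕ) (v : PotentialAlgebra (normalForm p)), X ^ m ∣ q →
      q.coeff m ≠ 0 → aeval (π y) q * v = 0 → π y ^ m * v = 0 := by
    rintro _ m v ⟨u, rfl⟩ hq h
    rw [coeff_X_pow_mul', if_pos le_rfl, Nat.sub_self] at hq
    rwa [mul_comm, map_mul, map_pow, aeval_X, mul_assoc, (hunit u hq).mul_right_eq_zero] at h
  have hyx : π y ^ b * π x = 0 := by
    refine hcancel _ b _ hb hb0 ?_
    have h1 := mul_aeval_of_anticomm hxy r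
    rw [← hxx, ← mul_assoc, hxx] at h1
    rw [map_sub, sub_mul, h1, sub_self]
  have hpow : ∀ m, π x * π y ^ m = (-1) ^ m * (π y ^ m * π x) := fun m => by
    have := mul_aeval_of_anticomm hxy (X ^ m : K[X])
    rw [map_pow, aeval_X, X_pow_comp, map_pow, map_neg, aeval_X, neg_pow, mul_assoc] at this
    exact this
  have hxyb : ∀ m, b ≤ m → π x * π y ^ m = 0 := fun m hm => by
    obtain ⟨l, rfl⟩ := Nat.exists_eq_add_of_le hm
    rw [pow_add, ← mul_assoc, hpow, hyx, mul_zero, zero_mul]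
  have hybc : ∀ m, b + c ≤ m → π y ^ m = 0 := fun m hm => by
    have h1 : π y ^ c * π y ^ b = 0 := by
      refine hcancel r c _ hc hc0 ?_
      have h2 : π y ^ b * (π x * π x) = 0 := by rw [← mul_assoc, hyx, zero_mul]
      have h3 : Commute (aeval (π y) r) (π y ^ b) := by
        have := (Commute.all r (X ^ b)).map (aeval (π y))
        rwa [map_pow, aeval_X] at this
      rw [h3.eq, ← hxx, h2]
    obtain ⟨l, rfl⟩ := Nat.exists_eq_add_of_le hm
    rw [pow_add, add_comm b, pow_add, h1, zero_mul]
  have htop : Submodule.span K (Set.range (Sum.elim (fun N : ℕ => π y ^ N)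
      fun N : ℕ => π x * π y ^ N)) = ⊤ := by
    refine mem_of_stable hN (Submodule.subset_span ⟨Sum.inl 0, pow_zero _⟩) fun v hv =>
      span_monomials_mul_mem hxy hxx hv
  rw [eq_top_iff, ← htop]
  refine Submodule.span_le.2 ?_
  rintro _ ⟨m | m, rfl⟩
  · change π y ^ m ∈ _
    by_cases hm : b + c ≤ m
    · rw [hybc m hm]; exact zero_mem _
    · refine Submodule.subset_span ⟨Sum.inl ⟨m, by omega⟩, ?_⟩
      change π (y ^ m) = _
      rw [map_pow]
  · change π x * π y ^ m ∈ _
    by_cases hm : b ≤ m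
    · rw [hxyb m hm]; exact zero_mem _
    · refine Submodule.subset_span ⟨Sum.inr ⟨m, by omega⟩, ?_⟩
      change π (x * y ^ m) = _
      rw [map_mul, map_pow]

/-- The coefficient of `t^(i+3)` in `r` is `-(i+4)/3` times that of `t^i` in `p`. The shift by 3
exchanges parities, so the odd part of `r` reflects the even part of `p`. -/
theorem exists_derivative_eq_smul (p : K[X]) :
    ∃ r : K[X], derivative (X ^ 4 * p) = (-3 : K) • r ∧ (∀ i < 3, r.coeff i = 0) ∧
      ∀ i, r.coeff (i + 3) = 0 ↔ p.coeff i = 0 := by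
  have h3 : (-3 : K) ≠ 0 := neg_ne_zero.2 three_ne_zero
  refine ⟨(-3 : K)⁻¹ • derivative (X ^ 4 * p), by rw [smul_inv_smul₀ h3], fun i hi => ?_,
    fun i => ?_⟩
  · rw [Polynomial.coeff_smul, coeff_derivative, coeff_X_pow_mul', if_neg (by omega), zero_mul,
      smul_zero]
  · rw [Polynomial.coeff_smul, coeff_derivative, coeff_X_pow_mul', if_pos (by omega), smul_eq_mul,
      mul_eq_zero, or_iff_right (inv_ne_zero h3), mul_eq_zero, or_iff_left (by norm_cast),
      show i + 3 + 1 - 4 = i by omega]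

theorem coeff_sub_comp_neg_X_eq_zero_iff (r : K[X]) (i : ℕ) :
    (r - r.comp (-X)).coeff i = 0 ↔ (Odd i → r.coeff i = 0) := by
  rw [Polynomial.coeff_sub, coeff_comp_neg_X]
  rcases Nat.even_or_odd i with h | h
  · simp [h.neg_one_pow, Nat.not_odd_iff_even.2 h]
  · rw [h.neg_one_pow, neg_one_mul, sub_neg_eq_add, ← two_mul, mul_eq_zero,
      or_iff_right two_ne_zero]
    simp [h]

/-- If it vanished, `r` would be even and the model would exist for every `a = b`, giving `2 * a`
independent elements. -/
theorem evenPart_ne_zero_of_finite {p : K[X]} [Module.Finite K (PotentialAlgebra (normalForm p))] :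
    evenPart p ≠ 0 := by
  intro h
  obtain ⟨r, hr, hr0, hrp⟩ := exists_derivative_eq_smul p
  set L := Module.finrank K (PotentialAlgebra (normalForm p)) + 1 with hL
  have hodd : r - r.comp (-X) = 0 := by
    ext i
    rw [Polynomial.coeff_zero, coeff_sub_comp_neg_X_eq_zero_iff]
    intro hi
    by_cases hi3 : i < 3
    · exact hr0 i hi3
    obtain ⟨j, rfl⟩ := Nat.exists_eq_add_of_le' (not_lt.1 hi3)
    have hj : Even j := by
      rcases Nat.even_or_odd j with hj | hj
      · exact hj
      · exact absurd (hj.add_odd (by decide : Odd 3)) (Nat.not_even_iff_odd.2 hi)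
    have := coeff_evenPart p j
    rw [h, Polynomial.coeff_zero, if_pos hj] at this
    exact (hrp j).2 this.symm
  have hX : X ∣ r := X_dvd_iff.2 (hr0 0 (by omega))
  have hli := linearIndependent_monomials_of_dvd hr (a := L) (b := L) hX le_rfl (dvd_mul_right _ _)
    (by rw [hodd]; exact dvd_zero _)
  have := hli.fintype_card_le_finrank
  rw [Fintype.card_sum, Fintype.card_fin] at this
  omega

theorem exists_basis_normalForm {p : K[X]} [Module.Finite K (PotentialAlgebra (normalForm p))] :
    ∃ k n : ℕ, p.natTrailingDegree = k ∧ (evenPart p).natTrailingDegree = 2 * n ∧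
      LinearIndependent K (monomials (normalForm p) n k) ∧
      Submodule.span K (Set.range (monomials (normalForm p) n k)) = ⊤ ∧
      (k = 2 * n ∨ (k < 2 * n ∧ Odd k)) := by
  obtain ⟨N, hN⟩ := exists_filt_le_of_finite (jacobianIdeal (normalForm p))
  have hE : evenPart p ≠ 0 := evenPart_ne_zero_of_finite
  have hp : p ≠ 0 := by
    rintro rfl
    exact hE (by simp [evenPart])
  obtain ⟨r, hr, hr0, hrp⟩ := exists_derivative_eq_smul p
  set k := p.natTrailingDegree with hk
  have hk0 : p.coeff k ≠ 0 := coeff_natTrailingDegree_ne_zero.2 hp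
  set m := (evenPart p).natTrailingDegree with hm
  have hm0 : (evenPart p).coeff m ≠ 0 := coeff_natTrailingDegree_ne_zero.2 hE
  rw [coeff_evenPart] at hm0
  have hme : Even m := by
    by_contra h
    exact hm0 (if_neg h)
  rw [if_pos hme] at hm0
  obtain ⟨n, hn⟩ := even_iff_two_dvd.1 hme
  have hkm : k ≤ m := natTrailingDegree_le_of_ne_zero hm0
  have hc : X ^ (k + 3) ∣ r := X_pow_dvd_iff.2 fun d hd => by
    by_cases hd3 : d < 3
    · exact hr0 d hd3
    obtain ⟨j, rfl⟩ := Nat.exists_eq_add_of_le' (not_lt.1 hd3)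
    exact (hrp j).2 (coeff_eq_zero_of_lt_natTrailingDegree (by omega))
  have hc0 : r.coeff (k + 3) ≠ 0 := fun h => hk0 ((hrp k).1 h)
  have hb : X ^ (2 * n + 3) ∣ r - r.comp (-X) := X_pow_dvd_iff.2 fun d hd => by
    rw [coeff_sub_comp_neg_X_eq_zero_iff]
    intro hdo
    by_cases hd3 : d < 3
    · exact hr0 d hd3
    obtain ⟨j, rfl⟩ := Nat.exists_eq_add_of_le' (not_lt.1 hd3)
    have hj : Even j := by
      rcases Nat.even_or_odd j with hj | hj
      · exact hj
      · exact absurd (hj.add_odd (by decide : Odd 3)) (Nat.not_even_iff_odd.2 hdo)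
    have := coeff_evenPart p j
    rw [if_pos hj, coeff_eq_zero_of_lt_natTrailingDegree (by omega)] at this
    exact (hrp j).2 this.symm
  have hb0 : (r - r.comp (-X)).coeff (2 * n + 3) ≠ 0 := by
    rw [Ne, coeff_sub_comp_neg_X_eq_zero_iff]
    intro h
    refine hm0 ((hrp m).1 ?_)
    rw [hn]
    exact h ⟨n + 1, by ring⟩
  refine ⟨k, n, rfl, hn, ?_, ?_, ?_⟩
  -- Here `b = 2n + 3` and `a = b + (k + 3)`, the largest exponent for which `t^a` divides `t^b r`;
  -- it agrees with the spanning bound.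
  · refine linearIndependent_monomials_of_dvd hr ((dvd_pow_self X (by omega)).trans hc) (by omega)
      ?_ hb
    rw [show 2 * n + k + 6 = (2 * n + 3) + (k + 3) by omega, pow_add]
    exact mul_dvd_mul_left _ hc
  · have := span_monomials_eq_top hr hN hc hc0 hb hb0
    rw [show 2 * n + 3 + (k + 3) = 2 * n + k + 6 by omega] at this
    exact this
  · rcases Nat.even_or_odd k with h | h
    · left
      have h1 := coeff_evenPart p k
      rw [if_pos h] at h1
      have h2 : m ≤ k := natTrailingDegree_le_of_ne_zero (by rwa [h1])
      omega
    · right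
      refine ⟨?_, h⟩
      rcases hkm.lt_or_eq with h1 | h1
      · omega
      · rw [h1] at h
        exact absurd hme (Nat.not_even_iff_odd.2 h)

end

end PotAlg

end

theorem theorem2 {K : Type*} [Field K] [CharZero K] (r : ℕ)
    (Fd : ℕ → PotAlg.NCSeries K) (hFd : ∀ d, PotAlg.IsHomogeneous (Fd d) d)
    (F : PotAlg.NCSeries K) (hF : F = PotAlg.xxyCyc + ∑ d ∈ Finset.Icc 4 r, Fd d)
    (hfin : Module.Finite K (PotAlg.PotentialAlgebra F)) :
    (∃ φ ∈ Submonoid.closure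
        {ψ : PotAlg.NCSeries K ≃ₐ[K] PotAlg.NCSeries K | PotAlg.IsElementaryChange ψ},
      ∃ p : Polynomial K, PotAlg.CycEquiv (φ F) (PotAlg.normalForm p)) ∧
    (∀ (φ : PotAlg.NCSeries K ≃ₐ[K] PotAlg.NCSeries K) (p : Polynomial K),
      PotAlg.CycEquiv (φ F) (PotAlg.normalForm p) →
      PotAlg.evenPart p ≠ 0 ∧
      Nonempty (PotAlg.PotentialAlgebra F ≃ₐ[K]
        PotAlg.PotentialAlgebra (PotAlg.normalForm p)) ∧
      ∃ k n : ℕ, p.natTrailingDegree = k ∧ (PotAlg.evenPart p).natTrailingDegree = 2 * n ∧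
        LinearIndependent K (PotAlg.monomials (PotAlg.normalForm p) n k) ∧
        Submodule.span K (Set.range (PotAlg.monomials (PotAlg.normalForm p) n k)) = ⊤ ∧
        ((k = 2 * n ∧ Module.finrank K (PotAlg.PotentialAlgebra F) = 3 * (2 * n + 3)) ∨
          (k < 2 * n ∧ Odd k ∧
            Module.finrank K (PotAlg.PotentialAlgebra F) = 4 * n + k + 9))) := by
  refine ⟨PotAlg.exists_elementary_normalForm ?_, fun φ p h => ?_⟩
  · rw [hF, add_sub_cancel_left]
    refine sum_mem fun d hd w hw => hFd d w ?_
    have := (Finset.mem_Icc.1 hd).1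
    omega
  · obtain ⟨e⟩ := PotAlg.nonempty_potentialAlgebra_equiv φ h
    have hfin' : Module.Finite K (PotAlg.PotentialAlgebra (PotAlg.normalForm p)) :=
      Module.Finite.equiv e.toLinearEquiv
    obtain ⟨k, n, hk, hn, hli, hspan, hkn⟩ := PotAlg.exists_basis_normalForm (p := p)
    have hrank : Module.finrank K (PotAlg.PotentialAlgebra F) = 2 * n + k + 6 + (2 * n + 3) := by
      rw [e.toLinearEquiv.finrank_eq, Module.finrank_eq_card_basis (Module.Basis.mk hli hspan.ge),
        Fintype.card_sum, Fintype.card_fin, Fintype.card_fin]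
    refine ⟨PotAlg.evenPart_ne_zero_of_finite, ⟨e⟩, k, n, hk, hn, hli, hspan, ?_⟩
    rcases hkn with h1 | ⟨h1, h2⟩
    · exact Or.inl ⟨h1, by omega⟩
    · exact Or.inr ⟨h1, h2, by omega⟩
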